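/- **Setting.** Let $\beta>1$ be real. For $x\in[0,1)$ let $d_\beta(x)=c_1c_2\cdots$ be the greedy $\beta$-expansion of $x$: $c_j=\lfloor \beta\,T^{j-1}(x)\rfloor$ with $T(y)=\beta y-\lfloor\beta y\rfloor$. The $\beta$-expansion $d_\beta(1)=t_1t_2\cdots$ of $1$ is $(\beta-1)^\omega$ if $\beta\in\mathbb N$; otherwise $t_1=\lceil\beta\rceil-1$ and, for $j\ge 2$, $t_j$ is the $j$-th digit of $d_\beta(1-t_1/\beta)$. The number $\beta$ is a *Parry number* if $d_\beta(1)$ is ultimately periodic. For a Parry number $\beta$, define the sequence $U_\beta=(U_\beta(n))_{n\ge0}$ as follows. * If $d_\beta(1)=t_1\cdots t_m0^\omega$ with $t_m\ne0$: $U_\beta(i)=t_1U_\beta(i-1)+\cdots+t_iU_\beta(0)+1$ for $0\le i<m$ (so $U_\beta(0)=1$), and $U_\beta(n)=t_1U_\beta(n-1)+\cdots+t_mU_\beta(n-m)$ for $n\ge m$. * Otherwise $d_\beta(1)=t_1\cdots t_m(t_{m+1}\cdots t_{m+k})^\omega$ with $m\ge 0$, $k\ge 1$ minimal: $U_\beta(i)=t_1U_\beta(i-1)+\cdots+t_iU_\beta(0)+1$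 for $0\le i<m+k$, and, for $n\ge m+k$, $U_\beta(n)=t_1U_\beta(n-1)+\cdots+t_{m+k}U_\beta(n-m-k)+U_\beta(n-k)-t_1U_\beta(n-k-1)-\cdots-t_mU_\beta(n-m-k)$. Let $L$ be the set of greedy $U_\beta$-representations $\mathrm{rep}(n)$ of the integers $n\ge 0$ (most significant digit first, nonzero leading digit, $\mathrm{rep}(0)=\varepsilon$), and let $\mathrm{val}(d_r\cdots d_0)=\sum_j d_jU_\beta(j)$. For words $u,v$, let $\binom uv$ be the number of occurrences of $v$ as a (scattered) subsequence of $u$. Put $A=\{0,\dots,\lceil\beta\rceil-1\}$ and $Q=[0,1]^2$. **The sets $\mathcal U_n$.** For $n\ge0$, $$\mathcal U_n=\frac1{U_\beta(n)}\bigcup\Big\{(\mathrm{val}(v),\mathrm{val}(u))+Q \;:\; u,v\in L,\ \mathrm{val}(u)<U_\beta(n),\ \mathrm{val}(v)<U_\beta(n),\ \tbinom uv\ \text{odd}\Big\}.$$ **The sets $\mathcal A_n$.** For nonempty $u,v\in L$ let $p(u,v)$ be the least $p\ge0$ with $\{w: u0^pw\in L\}=\{w: v0^pw\in L\}=0^*L$,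 and set $p(\varepsilon,\varepsilon)=0$. A pair $(u,v)\in L\times L$ satisfies $(\star)$ if either $u=v=\varepsilon$, or $|u|\ge|v|>0$ and, with $p=p(u,v)$, $\binom{u0^p}{v0^p}$ is odd and $\binom{u0^p}{v0^pa}=0$ for all $a\in A$. For a word $w=w_1\cdots w_\ell$ write $0.w=\sum_{j=1}^{\ell}w_j\beta^{-j}$. For $(u,v)$ satisfying $(\star)$ let $S_{u,v}$ be the closed segment with endpoints $(0.0^{|u|-|v|}v,\;0.u)$ and $(0.0^{|u|-|v|}v,\;0.u)+(\beta^{-|u|-p(u,v)},\beta^{-|u|-p(u,v)})$. Let $\mathcal A_0$ be the closure of the union of the segments $S_{u,v}$ over all $(u,v)$ satisfying $(\star)$. With $c(x,y)=(x/\beta,y/\beta)$ and $h(x,y)=(x,\beta y)$, let $$\mathcal A_n=\bigcup_{0\le j\le i\le n}h^j(c^i(\mathcal A_0))\qquad(n\ge0).$$ **Theorem.** Let $\beta>1$ be a Parry number. Then all $\mathcal U_n$ and $\mathcal A_n$ are nonempty compact subsets of $\mathbb R^2$. For the Hausdorff metric induced by the Euclidean distance, $(\mathcal A_n)_{n\ge0}$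 converges to a nonempty compact set $\mathcal L_\beta$, and $(\mathcal U_n)_{n\ge0}$ converges to the same set $\mathcal L_\beta$. -/

import Mathlib

open Filter Topology TopologicalSpace
open scoped Pointwise

noncomputable section

namespace ParryBertrand

/-! ### Words and binomial coefficients

Finite words over an alphabet of integer digits are lists, written from the most significant
(leftmost) letter; infinite words `t₁ t₂ t₃ ⋯` are functions `t : ℕ → ℤ`, where `t i` is the
letter `t_{i+1}`. -/

/-- The binomial coefficient of the words `u` and `v`: the number of occurrences of `v` as a
subsequence of `u`. (`u.sublists` lists the subsequences of `u`, one for each set of positions.) -/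
def binom (u v : List ℤ) : ℕ := u.sublists.count v

/-- The word `0^k`. -/
def zeros (k : ℕ) : List ℤ := List.replicate k 0

/-- The language `0^* L`. -/
def zeroStar (L : Set (List ℤ)) : Set (List ℤ) := {w | ∃ k : ℕ, ∃ x ∈ L, w = zeros k ++ x}

/-- The left quotient `u⁻¹.L = {x | u x ∈ L}`. -/
def leftQuot (u : List ℤ) (L : Set (List ℤ)) : Set (List ℤ) := {x | u ++ x ∈ L}

/-! ### Expansions in a real base -/

/-- The letter of index `i + 1` of the greedy `β`-expansion of `x ∈ [0, 1)`: it is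
`⌊β Tⁱ(x)⌋`, where `T(y) = β y - ⌊β y⌋`. -/
def betaExpansion (β x : ℝ) (i : ℕ) : ℤ := ⌊β * (fun y : ℝ => Int.fract (β * y))^[i] x⌋

/-- The `β`-expansion `d_β(1) = t₁ t₂ ⋯` of `1` (`dOne β i` is `t_{i+1}`). It is `(β - 1)^ω` if `β` is
an integer. Otherwise `t₁ = ⌈β⌉ - 1`, and the letters `t₂ t₃ ⋯` are the letters of index `2, 3, …` of
the `β`-expansion of `1 - t₁ / β` (whose letter of index `1` is `0`). -/
def dOne (β : ℝ) (i : ℕ) : ℤ :=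
  open Classical in
  if (∃ b : ℤ, β = b) ∨ i = 0 then ⌈β⌉ - 1
  else betaExpansion β (1 - ((⌈β⌉ - 1 : ℤ) : ℝ) / β) i

/-- `t = t₁ ⋯ t_m (t_{m+1} ⋯ t_{m+k})^ω`. -/
def HasPeriod (t : ℕ → ℤ) (m k : ℕ) : Prop := 0 < k ∧ ∀ i, m ≤ i → t (i + k) = t i

/-- `β > 1` is a Parry number if `d_β(1)` is ultimately periodic. -/
def IsParry (β : ℝ) : Prop := 1 < β ∧ ∃ m k, HasPeriod (dOne β) m k

/-- The infinite word `t` is finite: it ends in `0^ω`. -/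
def IsFinite (t : ℕ → ℤ) : Prop := ∃ m, ∀ i, m ≤ i → t i = 0

/-- The length `m` of a finite `t = t₁ ⋯ t_m 0^ω` with `t_m ≠ 0`. -/
def finLength (t : ℕ → ℤ) : ℕ := sInf {m | ∀ i, m ≤ i → t i = 0}

/-- The minimal preperiod of an ultimately periodic word. -/
def preperiod (t : ℕ → ℤ) : ℕ := sInf {m | ∃ k, HasPeriod t m k}

/-- The minimal period of an ultimately periodic word. -/
def period (t : ℕ → ℤ) : ℕ := sInf {k | HasPeriod t (preperiod t) k}

/-! ### The Parry–Bertrand numeration system -/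

/-- The sequence with `U(i) = t₁ U(i-1) + ⋯ + t_i U(0) + 1` for `0 ≤ i < m` and
`U(n) = t₁ U(n-1) + ⋯ + t_m U(n-m)` for `n ≥ m`. -/
def seqFinite (t : ℕ → ℤ) (m : ℕ) (n : ℕ) : ℤ :=
  if n < m then (∑ i : Fin n, t i * seqFinite t m (n - 1 - i)) + 1
  else ∑ i : Fin m, t i * seqFinite t m (n - 1 - i)
termination_by n
decreasing_by all_goals omega

/-- The sequence with `U(i) = t₁ U(i-1) + ⋯ + t_i U(0) + 1` for `0 ≤ i < m + k` and, for `n ≥ m + k`,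
`U(n) = t₁ U(n-1) + ⋯ + t_{m+k} U(n-m-k) + U(n-k) - t₁ U(n-k-1) - ⋯ - t_m U(n-m-k)`.
Here `k ≥ 1`; the value for `k = 0` is irrelevant. -/
def seqPeriodic (t : ℕ → ℤ) (m k : ℕ) (n : ℕ) : ℤ :=
  if n < m + k then (∑ i : Fin n, t i * seqPeriodic t m k (n - 1 - i)) + 1
  else if 0 < k then
    (∑ i : Fin (m + k), t i * seqPeriodic t m k (n - 1 - i)) + seqPeriodic t m k (n - k)
      - ∑ i : Fin m, t i * seqPeriodic t m k (n - k - 1 - i)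
  else 0
termination_by n
decreasing_by all_goals omega

/-- The sequence `U_β` of the Parry–Bertrand numeration system of a Parry number `β`. -/
def U (β : ℝ) : ℕ → ℤ :=
  open Classical in
  if IsFinite (dOne β) then seqFinite (dOne β) (finLength (dOne β))
  else seqPeriodic (dOne β) (preperiod (dOne β)) (period (dOne β))

/-- The word `c_{ℓ-1} ⋯ c_0` of quotients of the successive Euclidean divisions of `n` by
`U(ℓ-1), …, U(0)`. -/
def greedyWord (U : ℕ → ℤ) : ℕ → ℤ → List ℤ
  | 0, _ => []
  | ℓ + 1, n => n / U ℓ :: greedyWord U ℓ (n % U ℓ)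

/-- The normal `U`-representation of `n`: the greedy word of length the least `ℓ` with `n < U(ℓ)`.
In particular the representation of `0` is the empty word. -/
def rep (U : ℕ → ℤ) (n : ℕ) : List ℤ := greedyWord U (sInf {ℓ | (n : ℤ) < U ℓ}) n

/-- The language `L_U` of the normal `U`-representations of the natural numbers. -/
def language (U : ℕ → ℤ) : Set (List ℤ) := Set.range (rep U)

/-- The `U`-numerical value of a word: `val(d_r ⋯ d_0) = ∑ d_j U(j)`. -/
def val (U : ℕ → ℤ) : List ℤ → ℤ
  | [] => 0
  | d :: w => d * U w.length + val U w

/-! ### The sets `𝒰_n` -/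

/-- The Euclidean plane. -/
abbrev Plane : Type := EuclideanSpace ℝ (Fin 2)

/-- The square `Q = [0, 1] × [0, 1]`. -/
def unitSquare : Set Plane := {q | ∀ i, q i ∈ Set.Icc (0 : ℝ) 1}

/-- The set `𝒰_n`: the union of the squares `((val v, val u) + Q) / U_β(n)` for the words `u, v` of
the language that index the first `U_β(n)` rows and columns and have an odd binomial coefficient. -/
def pascalSet (β : ℝ) (n : ℕ) : Set Plane :=
  ((U β n : ℝ)⁻¹) • ⋃ (u ∈ language (U β)) (v ∈ language (U β)) (_ : val (U β) u < U β n)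
    (_ : val (U β) v < U β n) (_ : Odd (binom u v)),
      ((!₂[(val (U β) v : ℝ), (val (U β) u : ℝ)] : Plane) +ᵥ unitSquare)

/-! ### The `(⋆)` condition and the sets `𝒜_n` -/

/-- `p(u, v)`: the least `p` with `(u0^p)⁻¹.L = (v0^p)⁻¹.L = 0^* L` for nonempty `u, v ∈ L`, and
`p(ε, ε) = 0`. -/
def p (β : ℝ) (u v : List ℤ) : ℕ :=
  if u = [] ∧ v = [] then 0
  else sInf {p | leftQuot (u ++ zeros p) (language (U β)) = zeroStar (language (U β)) ∧
    leftQuot (v ++ zeros p) (language (U β)) = zeroStar (language (U β))}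

/-- The `(⋆)` condition for a pair of words of the language. -/
def Star (β : ℝ) (u v : List ℤ) : Prop :=
  (u = [] ∧ v = []) ∨
  (v.length ≤ u.length ∧ 0 < v.length ∧
    Odd (binom (u ++ zeros (p β u v)) (v ++ zeros (p β u v))) ∧
    ∀ a : ℤ, 0 ≤ a → a ≤ ⌈β⌉ - 1 →
      binom (u ++ zeros (p β u v)) (v ++ zeros (p β u v) ++ [a]) = 0)

/-- The real number `0.w = w₁ β⁻¹ + w₂ β⁻² + ⋯ + w_n β⁻ⁿ` for a word `w = w₁ ⋯ w_n`. -/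
def realVal (β : ℝ) : List ℤ → ℝ
  | [] => 0
  | d :: w => (d + realVal β w) / β

/-- The endpoint `A_{u,v} = (0.0^{|u|-|v|}v, 0.u)`. -/
def endA (β : ℝ) (u v : List ℤ) : Plane :=
  !₂[realVal β (zeros (u.length - v.length) ++ v), realVal β u]

/-- The endpoint `B_{u,v} = A_{u,v} + (β^{-|u|-p(u,v)}, β^{-|u|-p(u,v)})`. -/
def endB (β : ℝ) (u v : List ℤ) : Plane :=
  endA β u v + !₂[(β ^ (u.length + p β u v))⁻¹, (β ^ (u.length + p β u v))⁻¹]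

/-- The set `𝒜_0`: the closure of the union of the closed segments `S_{u,v} = [A_{u,v}, B_{u,v}]`
over the pairs of words of the language satisfying `(⋆)`. -/
def segSet₀ (β : ℝ) : Set Plane :=
  closure (⋃ (u ∈ language (U β)) (v ∈ language (U β)) (_ : Star β u v),
    segment ℝ (endA β u v) (endB β u v))

/-- The homothety of center `(0, 0)` and ratio `1 / β`. -/
def c (β : ℝ) (q : Plane) : Plane := (1 / β) • q

/-- The map `(x, y) ↦ (x, β y)`. -/
def h (β : ℝ) (q : Plane) : Plane := !₂[q 0, β * q 1]

/-- The set `𝒜_n`, the union of the sets `h^j(c^i(𝒜_0))` for `0 ≤ j ≤ i ≤ n`. -/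
def segSet (β : ℝ) (n : ℕ) : Set Plane :=
  ⋃ (i : ℕ) (j : ℕ) (_ : i ≤ n) (_ : j ≤ i), (h β)^[j] '' ((c β)^[i] '' segSet₀ β)

end ParryBertrand

end

/-!
The sets `𝒜_n` increase and stay in a fixed bounded box, so they converge to the closure `limitSet`
of their union; the point is that the sets `𝒰_n` have the same limit.

*The language.* Both versions of the recurrence of `U_β` say that
`U(n) = t₁ U(n-1) + ⋯ + t_n U(0) + 1` for the *quasi-greedy* expansion `t` of `1`
(`IsParry.exists_isParryBertrand`). If `r j ∈ (0, 1]` is the orbit of `1` which produces `t`, then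
comparing a word `s` with `r j` and comparing its value with
`t_{j+1} U(n-1) + ⋯ + t_{j+n} U(0) + 1` are the same thing (`IsParryBertrand.realVal_lt_iff`). This
gives the Bertrand property in the form: `0^* L` is the set of words with nonnegative digits all of
whose suffixes `s` satisfy `0.s < 1` (`IsParryBertrand.isGreedy_iff`). As `β` is a Parry number,
the orbit of `1` is finite and hence bounded below by some `δ > 0`; therefore `x 0^K w` is
admissible for all admissible `x`, `w` as soon as `β^{-K} ≤ δ`
(`IsQuasiGreedy.exists_isAdmissible_append`), and the integers `p(u, v)` exist.

*Values.* The numbers `U(n) β^{-n}` satisfy a renewal equation with weights `t_i β^{-i}`. Its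
solution converges: along an ultrafilter realising the largest (or smallest) cluster value all the
shifts of the sequence have the same limit, and a conserved quantity determines this limit
(`tendsto_of_renewal`). Hence `U(n) / U(n+1) → 1 / β`, and `val w / U(n)` is uniformly close to
`0.w` for the words `w` of `0^* L` of length `n`, which reduces everything to words and real
numbers.

*The segments are limits.* If `(u, v)` satisfies `(⋆)`, each occurrence of `v 0^p w` in `u 0^p w`
splits as an occurrence of `v 0^p` in `u 0^p` followed by `w`, so the coefficient stays odd
(`binom_append_append`). If `w` does not end with `0`, it stays odd when zeros are appended to the
first word. The corresponding corners in `𝒰_n` fill the images of `S_{u,v}`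
(`IsParryBertrand.eventually_exists_mem_pascalSet`).

*Nothing else appears.* Let `binom u v` be odd with `v` nonempty. Since
`(1 + X)^(2^q) = 1 + X^(2^q)` modulo `2`, the pair `(u 0^(2^q) 1, v 0^(2^q) 1)` still has an odd
coefficient when `2^q > |u|`, and it satisfies `(⋆)` (`odd_binom_append_zeros_one`). It has the
same leading digits as `(u, v)`, so the corner attached to `(u, v)` in `𝒰_n` is close to an
endpoint of a segment. If `v` is empty, the corner lies on the left side of the unit square, which
is the limit of the images `h^n(c^n(S_{ε,ε}))` of the diagonal
(`IsParryBertrand.eventually_exists_mem_limitSet`).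
-/

namespace ParryBertrand

/-! ### Binomial coefficients of words -/

lemma binom_nil_right (u : List ℤ) : binom u [] = 1 := by
  unfold binom
  induction u using List.reverseRecOn with
  | nil => simp
  | append_singleton u a ih =>
    rw [List.sublists_concat, List.count_append, ih]
    simp [List.count_eq_zero]

lemma binom_eq_zero_iff {u v : List ℤ} : binom u v = 0 ↔ ¬ v.Sublist u := by
  unfold binom
  rw [List.count_eq_zero, List.mem_sublists]

lemma binom_concat_concat (u v : List ℤ) (a b : ℤ) :
    binom (u ++ [a]) (v ++ [b]) = binom u (v ++ [b]) + if a = b then binom u v else 0 := by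
  unfold binom
  rw [List.sublists_concat, List.count_append]
  congr 1
  split_ifs with hab
  · subst hab
    exact List.count_map_of_injective _ _ (List.append_left_injective [a]) v
  · rw [List.count_eq_zero]
    simp only [List.mem_map, not_exists, not_and]
    intro x _ hx
    exact hab (by simpa using (List.append_inj' hx rfl).2)

lemma binom_self (u : List ℤ) : binom u u = 1 := by
  induction u using List.reverseRecOn with
  | nil => exact binom_nil_right []
  | append_singleton u a ih =>
    rw [binom_concat_concat, if_pos rfl, ih, binom_eq_zero_iff.2, zero_add]
    intro hs
    simpa using hs.length_le

lemma zeros_succ (k : ℕ) : zeros (k + 1) = zeros k ++ [0] := List.replicate_succ'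

lemma zeros_succ' (k : ℕ) : zeros (k + 1) = 0 :: zeros k := List.replicate_succ

@[simp] lemma length_zeros (k : ℕ) : (zeros k).length = k := List.length_replicate

@[simp] lemma zeros_zero : zeros 0 = [] := rfl

/-- If no letter of `w` can be appended to `v` inside `u`, then each occurrence of `v w` in `u w`
consists of an occurrence of `v` in `u` and of the final factor `w`. -/
lemma binom_append_append {u v : List ℤ} (w : List ℤ)
    (huv : ∀ a ∈ w, binom u (v ++ [a]) = 0) : binom (u ++ w) (v ++ w) = binom u v := by
  induction w generalizing u v with
  | nil => simp
  | cons a w ih =>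
    have e : ∀ x : List ℤ, x ++ a :: w = (x ++ [a]) ++ w := fun x => by simp
    rw [e u, e v, ih, binom_concat_concat, if_pos rfl, huv a (by simp), zero_add]
    intro b hb
    have ha := huv a (by simp)
    rw [binom_concat_concat, ha, ite_self, add_zero]
    rw [binom_eq_zero_iff] at ha ⊢
    exact fun hs => ha ((List.sublist_append_left _ _).trans hs)

lemma binom_append_append_concat {u v : List ℤ} (w : List ℤ) (b : ℤ)
    (huv : ∀ a : ℤ, binom u (v ++ [a]) = 0) : binom (u ++ w) (v ++ w ++ [b]) = 0 := by
  induction w using List.reverseRecOn generalizing b with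
  | nil => simpa using huv b
  | append_singleton w a ih =>
    rw [← List.append_assoc, ← List.append_assoc, binom_concat_concat, ih a, ite_self, add_zero]
    have ha := ih a
    rw [binom_eq_zero_iff] at ha ⊢
    exact fun hs => ha ((List.sublist_append_left _ _).trans hs)

lemma binom_append_zeros_concat (u v : List ℤ) {a : ℤ} (ha : a ≠ 0) (k : ℕ) :
    binom (u ++ zeros k) (v ++ [a]) = binom u (v ++ [a]) := by
  induction k with
  | zero => simp
  | succ k ih =>
    rw [zeros_succ, ← List.append_assoc, binom_concat_concat, ih, if_neg ha.symm, add_zero]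

/-- Modulo `2`, appending `0^(2^q)` acts on the generating series of the coefficients
`binom u (v 0^l)` as the multiplication by `(1 + X)^(2^q) = 1 + X^(2^q)`. -/
lemma binom_append_zeros_two_pow (u v : List ℤ) (q k l : ℕ) :
    (binom (u ++ zeros (k + 2 ^ q)) (v ++ zeros (l + 2 ^ q)) : ZMod 2) =
      binom (u ++ zeros k) (v ++ zeros (l + 2 ^ q)) + binom (u ++ zeros k) (v ++ zeros l) := by
  induction q generalizing k l with
  | zero =>
    rw [pow_zero, zeros_succ, zeros_succ, ← List.append_assoc, ← List.append_assoc,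
      binom_concat_concat, if_pos rfl]
    push_cast
    rfl
  | succ q ih =>
    have e : ∀ x : ℕ, x + 2 ^ (q + 1) = x + 2 ^ q + 2 ^ q := fun x => by ring
    rw [e k, e l, ih (k + 2 ^ q) (l + 2 ^ q), ih k (l + 2 ^ q), ih k l]
    have h2 : ∀ x : ZMod 2, x + x = 0 := by decide
    linear_combination h2 (binom (u ++ zeros k) (v ++ zeros (l + 2 ^ q)) : ZMod 2)

/-- From a pair with an odd binomial coefficient, appending `0^(2^q) 1` with `2^q > |u|` makes a
pair which has an odd binomial coefficient and whose second word cannot be extended. -/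
lemma odd_binom_append_zeros_one {u v : List ℤ} (huv : Odd (binom u v)) {q : ℕ}
    (hq : u.length < 2 ^ q) :
    Odd (binom (u ++ zeros (2 ^ q) ++ [1]) (v ++ zeros (2 ^ q) ++ [1])) ∧
      ∀ a : ℤ, binom (u ++ zeros (2 ^ q) ++ [1]) (v ++ zeros (2 ^ q) ++ [1] ++ [a]) = 0 := by
  have h0 : ∀ x : List ℤ, binom u (v ++ zeros (2 ^ q) ++ x) = 0 := fun x => by
    rw [binom_eq_zero_iff]
    intro hs
    have := hs.length_le
    simp only [List.length_append, length_zeros] at this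
    omega
  have h1 : binom (u ++ zeros (2 ^ q)) (v ++ zeros (2 ^ q) ++ [1]) = 0 := by
    rw [binom_append_zeros_concat _ _ one_ne_zero, h0]
  refine ⟨?_, fun a => ?_⟩
  · rw [binom_concat_concat, if_pos rfl, h1, zero_add, ← ZMod.natCast_eq_one_iff_odd]
    have := binom_append_zeros_two_pow u v q 0 0
    simp only [zero_add, zeros_zero, List.append_nil] at this
    rw [this, ZMod.natCast_eq_one_iff_odd.2 huv]
    have h00 := h0 []
    rw [List.append_nil] at h00
    rw [h00, Nat.cast_zero, zero_add]
  · rw [binom_concat_concat, h1, ite_self, add_zero]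
    rw [binom_eq_zero_iff] at h1 ⊢
    exact fun hs => h1 ((List.sublist_append_left _ _).trans hs)

/-! ### Greedy words of a numeration system -/

/-- `w` is a greedy word of `U`, possibly with leading zeros: its digits are nonnegative and each of
its nonempty suffixes `s` satisfies `val s < U |s|`. -/
def IsGreedy (U : ℕ → ℤ) : List ℤ → Prop
  | [] => True
  | d :: w => 0 ≤ d ∧ IsGreedy U w ∧ val U (d :: w) < U (w.length + 1)

lemma IsGreedy.val_nonneg {U : ℕ → ℤ} (hpos : ∀ n, 0 < U n) {w : List ℤ} (hw : IsGreedy U w) :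
    0 ≤ val U w := by
  induction w with
  | nil => exact le_rfl
  | cons d w ih => exact add_nonneg (mul_nonneg hw.1 (hpos _).le) (ih hw.2.1)

lemma IsGreedy.val_lt {U : ℕ → ℤ} (hpos : ∀ n, 0 < U n) {w : List ℤ} (hw : IsGreedy U w) :
    val U w < U w.length := by
  cases w with
  | nil => exact hpos 0
  | cons d w => exact hw.2.2

lemma length_greedyWord (U : ℕ → ℤ) (l : ℕ) (n : ℤ) : (greedyWord U l n).length = l := by
  induction l generalizing n with
  | zero => rfl
  | succ l ih => simp [greedyWord, ih]

lemma val_greedyWord {U : ℕ → ℤ} (h0 : U 0 = 1) (hpos : ∀ n, 0 < U n) (l : ℕ) {n : ℤ}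
    (hn : 0 ≤ n) (hnl : n < U l) : val U (greedyWord U l n) = n := by
  induction l generalizing n with
  | zero => simp only [greedyWord, val]; omega
  | succ l ih =>
    rw [greedyWord, val, length_greedyWord,
      ih (Int.emod_nonneg _ (hpos l).ne') (Int.emod_lt_of_pos _ (hpos l))]
    exact Int.ediv_mul_add_emod n (U l)

lemma isGreedy_greedyWord {U : ℕ → ℤ} (h0 : U 0 = 1) (hpos : ∀ n, 0 < U n) (l : ℕ) {n : ℤ}
    (hn : 0 ≤ n) (hnl : n < U l) : IsGreedy U (greedyWord U l n) := by
  induction l generalizing n with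
  | zero => trivial
  | succ l ih =>
    refine ⟨Int.ediv_nonneg hn (hpos l).le,
      ih (Int.emod_nonneg _ (hpos l).ne') (Int.emod_lt_of_pos _ (hpos l)), ?_⟩
    have := val_greedyWord h0 hpos (l + 1) hn hnl
    rw [greedyWord] at this
    rw [this, length_greedyWord]
    exact hnl

lemma IsGreedy.greedyWord_val {U : ℕ → ℤ} (hpos : ∀ n, 0 < U n) {w : List ℤ} (hw : IsGreedy U w) :
    greedyWord U w.length (val U w) = w := by
  induction w with
  | nil => rfl
  | cons d w ih =>
    have h1 := hw.2.1.val_nonneg hpos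
    have h2 := hw.2.1.val_lt hpos
    have hd : val U (d :: w) / U w.length = d := by
      rw [val, add_comm, Int.add_mul_ediv_right _ _ (hpos _).ne', Int.ediv_eq_zero_of_lt h1 h2,
        zero_add]
    have hm : val U (d :: w) % U w.length = val U w := by
      rw [val, add_comm, Int.add_mul_emod_self_right, Int.emod_eq_of_lt h1 h2]
    rw [List.length_cons, greedyWord, hd, hm, ih hw.2.1]

lemma IsGreedy.of_append {U : ℕ → ℤ} {x w : List ℤ} (h : IsGreedy U (x ++ w)) : IsGreedy U w := by
  induction x with
  | nil => exact h
  | cons d x ih => exact ih h.2.1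

lemma val_zeros_append (U : ℕ → ℤ) (k : ℕ) (w : List ℤ) : val U (zeros k ++ w) = val U w := by
  induction k with
  | zero => rfl
  | succ k ih => rw [zeros_succ', List.cons_append, val, ih, zero_mul, zero_add]

lemma isGreedy_zeros_append {U : ℕ → ℤ} (hpos : ∀ n, 0 < U n) (hmono : StrictMono U) (k : ℕ)
    {w : List ℤ} (hw : IsGreedy U w) : IsGreedy U (zeros k ++ w) := by
  induction k with
  | zero => exact hw
  | succ k ih =>
    rw [zeros_succ', List.cons_append]
    refine ⟨le_rfl, ih, ?_⟩
    rw [val, zero_mul, zero_add]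
    exact (ih.val_lt hpos).trans (hmono (Nat.lt_succ_self _))

lemma exists_lt_of_strictMono {U : ℕ → ℤ} (hmono : StrictMono U) (hpos : ∀ n, 0 < U n) (n : ℕ) :
    ∃ l, (n : ℤ) < U l := by
  refine ⟨n, ?_⟩
  induction n with
  | zero => exact_mod_cast hpos 0
  | succ n ih => have := hmono n.lt_add_one; push_cast; omega

lemma IsGreedy.length_le {U : ℕ → ℤ} (hpos : ∀ n, 0 < U n) (hmono : StrictMono U) {w : List ℤ}
    (hw : IsGreedy U w) (hd : w.head? ≠ some 0) {n : ℕ} (hn : val U w < U n) : w.length ≤ n := by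
  cases w with
  | nil => exact Nat.zero_le _
  | cons d w =>
    by_contra! hlt
    have h1 : U n ≤ U w.length := hmono.monotone (by simpa [Nat.lt_succ_iff] using hlt)
    have h2 : 1 ≤ d := by
      have := hw.1
      have : d ≠ 0 := by simpa using hd
      omega
    have h3 := hw.2.1.val_nonneg hpos
    have h4 : U w.length ≤ d * U w.length := le_mul_of_one_le_left (hpos _).le h2
    simp only [val] at hn
    omega

/-- The words of the language are the greedy words without a leading zero. -/
lemma mem_language_iff {U : ℕ → ℤ} (h0 : U 0 = 1) (hpos : ∀ n, 0 < U n) (hmono : StrictMono U)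
    {w : List ℤ} : w ∈ language U ↔ IsGreedy U w ∧ w.head? ≠ some 0 := by
  constructor
  · rintro ⟨n, rfl⟩
    have hl : (n : ℤ) < U (sInf {l | (n : ℤ) < U l}) :=
      Nat.sInf_mem (s := {l | (n : ℤ) < U l}) (exists_lt_of_strictMono hmono hpos n)
    refine ⟨isGreedy_greedyWord h0 hpos _ (by positivity) hl, ?_⟩
    unfold rep
    rcases hk : sInf {l | (n : ℤ) < U l} with _ | k
    · simp [greedyWord]
    · have hk' : ¬ (n : ℤ) < U k := fun h =>
        (Nat.notMem_of_lt_sInf (s := {l | (n : ℤ) < U l}) (m := k) (by omega)) h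
      have : 1 ≤ (n : ℤ) / U k := by
        rw [Int.le_ediv_iff_mul_le (hpos k)]; omega
      simp only [greedyWord, List.head?_cons, ne_eq, Option.some.injEq]
      omega
  · rintro ⟨hw, hd⟩
    have hv := hw.val_nonneg hpos
    refine ⟨(val U w).toNat, ?_⟩
    unfold rep
    rw [Int.toNat_of_nonneg hv]
    have : sInf {l | val U w < U l} = w.length := by
      refine le_antisymm (Nat.sInf_le (hw.val_lt hpos)) ?_
      exact le_csInf ⟨_, hw.val_lt hpos⟩ fun l hl => hw.length_le hpos hmono hd hl
    rw [this, hw.greedyWord_val hpos]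

/-- `0^* L` is the set of greedy words. -/
lemma mem_zeroStar_language_iff {U : ℕ → ℤ} (h0 : U 0 = 1) (hpos : ∀ n, 0 < U n)
    (hmono : StrictMono U) {w : List ℤ} : w ∈ zeroStar (language U) ↔ IsGreedy U w := by
  constructor
  · rintro ⟨k, x, hx, rfl⟩
    exact isGreedy_zeros_append hpos hmono k ((mem_language_iff h0 hpos hmono).1 hx).1
  · intro hw
    induction w with
    | nil => exact ⟨0, [], (mem_language_iff h0 hpos hmono).2 ⟨trivial, by simp⟩, rfl⟩
    | cons d w ih =>
      by_cases hd : d = 0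
      · obtain ⟨k, x, hx, rfl⟩ := ih hw.2.1
        exact ⟨k + 1, x, hx, by rw [zeros_succ', hd, List.cons_append]⟩
      · exact ⟨0, d :: w, (mem_language_iff h0 hpos hmono).2 ⟨hw, by simpa using hd⟩, rfl⟩

lemma finite_language_val_lt {U : ℕ → ℤ} (h0 : U 0 = 1) (hpos : ∀ n, 0 < U n)
    (hmono : StrictMono U) (n : ℕ) : {w | w ∈ language U ∧ val U w < U n}.Finite := by
  refine ((Finset.range (U n).toNat).finite_toSet.image (rep U)).subset ?_
  rintro w ⟨⟨m, rfl⟩, hm⟩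
  refine ⟨m, ?_, rfl⟩
  have hl : (m : ℤ) < U (sInf {l | (m : ℤ) < U l}) :=
    Nat.sInf_mem (s := {l | (m : ℤ) < U l}) (exists_lt_of_strictMono hmono hpos m)
  rw [rep, val_greedyWord h0 hpos _ (by positivity) hl] at hm
  simp only [Finset.coe_range, Set.mem_Iio]
  omega

/-! ### Quasi-greedy expansion of `1` and its numeration system -/

/-- `t` is the quasi-greedy expansion of `1` in base `β` and `r` is the orbit of `1` under the left
continuous version of `y ↦ β y - ⌊β y⌋`, with values in `(0, 1]`. -/
structure IsQuasiGreedy (β : ℝ) (t : ℕ → ℤ) (r : ℕ → ℝ) : Prop where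
  one_lt : 1 < β
  zero : r 0 = 1
  pos : ∀ j, 0 < r j
  le_one : ∀ j, r j ≤ 1
  step : ∀ j, β * r j = t j + r (j + 1)

/-- `tailSeq U t j n` is `t j * U (n - 1) + ⋯ + t (j + n - 1) * U 0 + 1`. When `t` is the quasi-greedy
expansion of `1`, it plays for words of length `n` the role that `r j` plays for real values. -/
def tailSeq (U : ℕ → ℤ) (t : ℕ → ℤ) : ℕ → ℕ → ℤ
  | _, 0 => 1
  | j, n + 1 => t j * U n + tailSeq U t (j + 1) n

lemma tailSeq_eq_sum (U t : ℕ → ℤ) (j n : ℕ) :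
    tailSeq U t j n = ∑ i ∈ Finset.range n, t (j + i) * U (n - 1 - i) + 1 := by
  induction n generalizing j with
  | zero => simp [tailSeq]
  | succ n ih =>
    rw [tailSeq, ih, Finset.sum_range_succ']
    simp only [add_zero, Nat.add_sub_cancel, Nat.sub_zero]
    rw [Finset.sum_congr rfl fun i _ => by
      rw [show j + 1 + i = j + (i + 1) by ring, show n - 1 - i = n - (i + 1) by omega]]
    ring

namespace IsQuasiGreedy

variable {β : ℝ} {t : ℕ → ℤ} {r : ℕ → ℝ}

lemma digit_nonneg (H : IsQuasiGreedy β t r) (j : ℕ) : 0 ≤ t j := by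
  have h1 := H.step j
  have h2 := mul_pos (zero_lt_one.trans H.one_lt) (H.pos j)
  have h3 := H.le_one (j + 1)
  have : (-1 : ℝ) < t j := by linarith
  have : (-1 : ℤ) < t j := by exact_mod_cast this
  omega

lemma one_le_digit_zero (H : IsQuasiGreedy β t r) : 1 ≤ t 0 := by
  have h1 := H.step 0
  have h3 := H.le_one (0 + 1)
  have := H.one_lt
  rw [H.zero] at h1
  have : (0 : ℝ) < t 0 := by linarith
  exact_mod_cast this

end IsQuasiGreedy

/-- `U` is the numeration system attached to the quasi-greedy expansion `t` of `1` in base `β`. -/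
structure IsParryBertrand (β : ℝ) (U t : ℕ → ℤ) (r : ℕ → ℝ) : Prop
    extends IsQuasiGreedy β t r where
  eq_tailSeq : ∀ n, U n = tailSeq U t 0 n

/-- `w` is admissible: its digits are nonnegative and each of its suffixes `s` satisfies
`0.s < 1`. -/
def IsAdmissible (β : ℝ) : List ℤ → Prop
  | [] => True
  | d :: w => 0 ≤ d ∧ IsAdmissible β w ∧ realVal β (d :: w) < 1

namespace IsParryBertrand

variable {β : ℝ} {U t : ℕ → ℤ} {r : ℕ → ℝ}

lemma tailSeq_pos (H : IsParryBertrand β U t r) (j n : ℕ) : 0 < tailSeq U t j n := by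
  induction n generalizing j with
  | zero => exact one_pos
  | succ n ih =>
    have h1 := ih 0
    rw [← H.eq_tailSeq] at h1
    exact add_pos_of_nonneg_of_pos (mul_nonneg (H.digit_nonneg j) h1.le) (ih _)

lemma U_pos (H : IsParryBertrand β U t r) (n : ℕ) : 0 < U n := by
  rw [H.eq_tailSeq]; exact H.tailSeq_pos 0 n

lemma U_zero (H : IsParryBertrand β U t r) : U 0 = 1 := H.eq_tailSeq 0

lemma strictMono (H : IsParryBertrand β U t r) : StrictMono U := by
  refine strictMono_nat_of_lt_succ fun n => ?_
  rw [H.eq_tailSeq (n + 1), tailSeq]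
  have h1 := H.tailSeq_pos (0 + 1) n
  have h2 : U n ≤ t 0 * U n := le_mul_of_one_le_left (H.U_pos n).le H.one_le_digit_zero
  omega

/-- The integer version of the lexicographic comparison of the shifts of `t`. -/
lemma tailSeq_le_tailSeq (H : IsParryBertrand β U t r) {i j : ℕ} (hij : r i ≤ r j) (n : ℕ) :
    tailSeq U t i n ≤ tailSeq U t j n := by
  induction n generalizing i j with
  | zero => exact le_rfl
  | succ n ih =>
    have hβ := zero_lt_one.trans H.one_lt
    have hs : (t i : ℝ) + r (i + 1) ≤ t j + r (j + 1) := by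
      rw [← H.step, ← H.step]; gcongr
    have hi := H.pos (i + 1)
    have hj := H.le_one (j + 1)
    have hlt : (t i : ℝ) < t j + 1 := by linarith
    have hlt : t i < t j + 1 := by exact_mod_cast hlt
    simp only [tailSeq]
    rcases (show t i = t j ∨ t i + 1 ≤ t j by omega) with h | h
    · rw [h] at hs ⊢
      have := ih (i := i + 1) (j := j + 1) (by linarith)
      omega
    · have h1 := ih (i := i + 1) (j := 0) (by rw [H.zero]; exact H.le_one _)
      rw [← H.eq_tailSeq] at h1
      have h2 := H.tailSeq_pos (j + 1) n
      have h3 : (t i + 1) * U n ≤ t j * U n := mul_le_mul_of_nonneg_right h (H.U_pos n).le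
      linarith

end IsParryBertrand

lemma IsAdmissible.realVal_nonneg {β : ℝ} (hβ : 1 < β) {w : List ℤ} (hw : IsAdmissible β w) :
    0 ≤ realVal β w := by
  induction w with
  | nil => exact le_rfl
  | cons d w ih =>
    exact div_nonneg (add_nonneg (by exact_mod_cast hw.1) (ih hw.2.1)) (zero_lt_one.trans hβ).le

lemma IsAdmissible.realVal_lt_one {β : ℝ} {w : List ℤ} (hw : IsAdmissible β w) :
    realVal β w < 1 := by
  cases w with
  | nil => exact one_pos
  | cons d w => exact hw.2.2

lemma IsAdmissible.digit_le {β : ℝ} (hβ : 1 < β) {w : List ℤ} (hw : IsAdmissible β w) {d : ℤ}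
    (hd : d ∈ w) : 0 ≤ d ∧ d ≤ ⌈β⌉ - 1 := by
  induction w with
  | nil => simp at hd
  | cons e w ih =>
    rcases List.mem_cons.1 hd with rfl | hd
    · refine ⟨hw.1, ?_⟩
      have h1 := hw.2.2
      rw [realVal, div_lt_one (zero_lt_one.trans hβ)] at h1
      have h2 := hw.2.1.realVal_nonneg hβ
      have : d < ⌈β⌉ := Int.lt_ceil.2 (by linarith)
      omega
    · exact ih hw.2.1 hd

lemma realVal_append (β : ℝ) (x w : List ℤ) :
    realVal β (x ++ w) = realVal β x + realVal β w / β ^ x.length := by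
  induction x with
  | nil => simp [realVal]
  | cons d x ih =>
    rw [List.cons_append, realVal, ih, realVal, List.length_cons, pow_succ, add_div, add_div,
      add_div, div_div]
    ring

lemma realVal_zeros (β : ℝ) (k : ℕ) : realVal β (zeros k) = 0 := by
  induction k with
  | zero => rfl
  | succ k ih => rw [zeros_succ', realVal, ih]; simp

lemma realVal_zeros_append (β : ℝ) (k : ℕ) (w : List ℤ) :
    realVal β (zeros k ++ w) = realVal β w / β ^ k := by
  rw [realVal_append, realVal_zeros, zero_add, length_zeros]

lemma realVal_append_zeros (β : ℝ) (k : ℕ) (w : List ℤ) :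
    realVal β (w ++ zeros k) = realVal β w := by
  rw [realVal_append, realVal_zeros, zero_div, add_zero]

namespace IsParryBertrand

variable {β : ℝ} {U t : ℕ → ℤ} {r : ℕ → ℝ}

lemma realVal_cons_lt_iff (H : IsParryBertrand β U t r) (d : ℤ) {w : List ℤ}
    (hw : IsGreedy U w) (hw' : IsAdmissible β w) {j : ℕ}
    (hj : realVal β w < r (j + 1) ↔ val U w < tailSeq U t (j + 1) w.length) :
    realVal β (d :: w) < r j ↔ val U (d :: w) < tailSeq U t j (w.length + 1) := by
  rw [realVal, div_lt_iff₀ (zero_lt_one.trans H.one_lt), mul_comm, H.step, val, tailSeq]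
  have a1 := hw'.realVal_nonneg H.one_lt
  have a2 := hw'.realVal_lt_one
  have b1 := hw.val_nonneg H.U_pos
  have b2 := hw.val_lt H.U_pos
  have c1 := H.pos (j + 1)
  have c2 := H.le_one (j + 1)
  have e1 := H.tailSeq_pos (j + 1) w.length
  have e2 := H.tailSeq_le_tailSeq (c2.trans_eq H.zero.symm) w.length
  rw [← H.eq_tailSeq] at e2
  rcases lt_trichotomy d (t j) with h | rfl | h
  · have h1 : (d : ℝ) + 1 ≤ t j := by exact_mod_cast h
    have h2 : (d + 1) * U w.length ≤ t j * U w.length :=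
      mul_le_mul_of_nonneg_right h (H.U_pos _).le
    exact iff_of_true (by linarith) (by linarith)
  · simpa using hj
  · have h1 : (t j : ℝ) + 1 ≤ d := by exact_mod_cast h
    have h2 : (t j + 1) * U w.length ≤ d * U w.length :=
      mul_le_mul_of_nonneg_right h (H.U_pos _).le
    exact iff_of_false (by linarith) (by linarith)

/-- Comparing the real value of a word with the orbit of `1` amounts to comparing its `U`-numerical
value with `tailSeq`. -/
lemma realVal_lt_iff (H : IsParryBertrand β U t r) {w : List ℤ} (hw : IsGreedy U w)
    (hw' : IsAdmissible β w) (j : ℕ) :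
    realVal β w < r j ↔ val U w < tailSeq U t j w.length := by
  induction w generalizing j with
  | nil => simp [realVal, val, tailSeq, H.pos j]
  | cons d w ih => exact H.realVal_cons_lt_iff d hw.2.1 hw'.2.1 (ih hw.2.1 hw'.2.1 (j + 1))

/-- The greedy words of `U` are the admissible words of the base `β`. -/
lemma isGreedy_iff (H : IsParryBertrand β U t r) {w : List ℤ} :
    IsGreedy U w ↔ IsAdmissible β w := by
  induction w with
  | nil => exact Iff.rfl
  | cons d w ih =>
    refine and_congr_right fun hd => ?_
    rw [← ih]
    refine and_congr_right fun hw => ?_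
    rw [← H.zero, H.eq_tailSeq,
      H.realVal_cons_lt_iff d hw (ih.1 hw) (H.realVal_lt_iff hw (ih.1 hw) (0 + 1))]

lemma mem_language (H : IsParryBertrand β U t r) {w : List ℤ} :
    w ∈ language U ↔ IsAdmissible β w ∧ w.head? ≠ some 0 := by
  rw [mem_language_iff H.U_zero H.U_pos H.strictMono, H.isGreedy_iff]

lemma mem_zeroStar (H : IsParryBertrand β U t r) {w : List ℤ} :
    w ∈ zeroStar (language U) ↔ IsAdmissible β w := by
  rw [mem_zeroStar_language_iff H.U_zero H.U_pos H.strictMono, H.isGreedy_iff]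

end IsParryBertrand

lemma isAdmissible_zeros_append {β : ℝ} (hβ : 1 < β) (k : ℕ) {w : List ℤ}
    (hw : IsAdmissible β w) : IsAdmissible β (zeros k ++ w) := by
  induction k with
  | zero => exact hw
  | succ k ih =>
    rw [zeros_succ', List.cons_append]
    refine ⟨le_rfl, ih, ?_⟩
    rw [realVal, Int.cast_zero, zero_add, div_lt_one (zero_lt_one.trans hβ)]
    exact ih.realVal_lt_one.trans hβ

lemma IsAdmissible.of_append {β : ℝ} {x w : List ℤ} (h : IsAdmissible β (x ++ w)) :
    IsAdmissible β w := by
  induction x with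
  | nil => exact h
  | cons d x ih => exact ih h.2.1

lemma isAdmissible_zeros {β : ℝ} (hβ : 1 < β) (k : ℕ) : IsAdmissible β (zeros k) := by
  simpa using isAdmissible_zeros_append hβ k (w := []) trivial

lemma isAdmissible_singleton_one {β : ℝ} (hβ : 1 < β) : IsAdmissible β [1] := by
  refine ⟨zero_le_one, trivial, ?_⟩
  rw [realVal, realVal, div_lt_one (zero_lt_one.trans hβ)]
  simpa using hβ

lemma IsAdmissible.append_zeros {β : ℝ} (hβ : 1 < β) (k : ℕ) {w : List ℤ}
    (hw : IsAdmissible β w) : IsAdmissible β (w ++ zeros k) := by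
  induction w with
  | nil => exact isAdmissible_zeros hβ k
  | cons d w ih =>
    refine ⟨hw.1, ih hw.2.1, ?_⟩
    change realVal β (d :: w ++ zeros k) < 1
    rw [realVal_append_zeros]
    exact hw.2.2

/-- An admissible word whose value is below an element of the orbit of `1` is quantitatively
below it, when the orbit stays away from `0`. -/
lemma IsQuasiGreedy.le_sub_realVal {β δ : ℝ} {t : ℕ → ℤ} {r : ℕ → ℝ} (H : IsQuasiGreedy β t r)
    (hδ : ∀ j, δ ≤ r j) {w : List ℤ} (hw : IsAdmissible β w) {j : ℕ} (hj : realVal β w < r j) :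
    δ / β ^ w.length ≤ r j - realVal β w := by
  induction w generalizing j with
  | nil => simpa [realVal] using hδ j
  | cons d w ih =>
    have hβ := zero_lt_one.trans H.one_lt
    have e : r j = (t j + r (j + 1)) / β := by rw [← H.step]; field_simp
    rw [e, realVal, div_lt_div_iff_of_pos_right hβ] at hj
    rw [e, realVal, ← sub_div, List.length_cons, pow_succ, ← div_div]
    gcongr
    have a1 := hw.2.1.realVal_lt_one
    have c2 := H.le_one (j + 1)
    have a2 := hw.2.1.realVal_nonneg H.one_lt
    have hdt : (d : ℝ) < t j + 1 := by linarith
    have hdt : d < t j + 1 := by exact_mod_cast hdt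
    rcases (show d = t j ∨ d + 1 ≤ t j by omega) with h | h
    · have := ih hw.2.1 (j := j + 1) (by rw [h] at hj; linarith)
      rw [h]; linarith
    · have := ih hw.2.1 (j := 0) (by rwa [H.zero])
      rw [H.zero] at this
      have h' : (d : ℝ) + 1 ≤ t j := by exact_mod_cast h
      have := H.pos (j + 1)
      linarith

/-- Two admissible words can be concatenated after inserting enough zeros. -/
lemma IsQuasiGreedy.exists_isAdmissible_append {β δ : ℝ} {t : ℕ → ℤ} {r : ℕ → ℝ}
    (H : IsQuasiGreedy β t r) (hδ0 : 0 < δ) (hδ : ∀ j, δ ≤ r j) :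
    ∃ K : ℕ, ∀ k, K ≤ k → ∀ x w, IsAdmissible β x → IsAdmissible β w →
      IsAdmissible β (x ++ zeros k ++ w) := by
  have hβ := zero_lt_one.trans H.one_lt
  obtain ⟨K, hK⟩ := pow_unbounded_of_one_lt δ⁻¹ H.one_lt
  refine ⟨K, fun k hk x w hx hw => ?_⟩
  have hk' : 1 / β ^ k ≤ δ := by
    rw [div_le_iff₀ (by positivity)]
    have h1 : β ^ K ≤ β ^ k := pow_le_pow_right₀ H.one_lt.le hk
    rw [inv_lt_iff_one_lt_mul₀ hδ0] at hK
    nlinarith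
  rw [List.append_assoc]
  have hz := isAdmissible_zeros_append H.one_lt k hw
  induction x with
  | nil => exact hz
  | cons d x ih =>
    refine ⟨hx.1, ih hx.2.1, ?_⟩
    change realVal β (d :: x ++ (zeros k ++ w)) < 1
    rw [realVal_append, realVal_zeros_append]
    have h1 := H.le_sub_realVal hδ hx (j := 0) (by rw [H.zero]; exact hx.realVal_lt_one)
    rw [H.zero] at h1
    have h2 : realVal β w / β ^ k < δ :=
      lt_of_lt_of_le (by have := hw.realVal_lt_one; gcongr) hk'
    have h3 : realVal β w / β ^ k / β ^ (d :: x).length < δ / β ^ (d :: x).length := by gcongr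
    linarith

/-- Each number of `[0, 1]` is within `β^{-n}` of the value of an admissible word of length `n`. -/
lemma exists_isAdmissible_abs_sub_le {β : ℝ} (hβ : 1 < β) (n : ℕ) {x : ℝ}
    (hx : x ∈ Set.Icc (0 : ℝ) 1) :
    ∃ w, IsAdmissible β w ∧ w.length = n ∧ |realVal β w - x| ≤ 1 / β ^ n := by
  have h0 := zero_lt_one.trans hβ
  have key : ∀ (n : ℕ) (x : ℝ), 0 < x → x ≤ 1 → ∃ w, IsAdmissible β w ∧ w.length = n ∧
      realVal β w < x ∧ x ≤ realVal β w + 1 / β ^ n := by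
    intro n
    induction n with
    | zero => exact fun x h1 h2 => ⟨[], trivial, rfl, h1, by simpa [realVal] using h2⟩
    | succ n ih =>
      intro x h1 h2
      have c1 := Int.le_ceil (β * x)
      have c2 := Int.ceil_lt_add_one (β * x)
      obtain ⟨w, hw, hl, h3, h4⟩ := ih (β * x - (⌈β * x⌉ - 1)) (by linarith) (by linarith)
      have e : realVal β ((⌈β * x⌉ - 1) :: w) = (⌈β * x⌉ - 1 + realVal β w) / β := by
        rw [realVal]; push_cast; rfl
      have hlt : realVal β ((⌈β * x⌉ - 1) :: w) < x := by
        rw [e, div_lt_iff₀ h0]; linarith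
      have hpos : 0 < ⌈β * x⌉ := Int.ceil_pos.2 (by positivity)
      refine ⟨(⌈β * x⌉ - 1) :: w, ⟨by omega, hw, hlt.trans_le h2⟩, by simp [hl], hlt, ?_⟩
      rw [e, pow_succ, ← div_div, ← add_div, le_div_iff₀ h0]
      linarith
  rcases hx.1.eq_or_lt with rfl | h
  · refine ⟨zeros n, isAdmissible_zeros hβ n, length_zeros n, ?_⟩
    rw [realVal_zeros, sub_zero, abs_zero]
    positivity
  · obtain ⟨w, hw, hl, h1, h2⟩ := key n x h hx.2
    exact ⟨w, hw, hl, by rw [abs_le]; constructor <;> linarith⟩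

/-! ### The numeration system of a Parry number -/

lemma eq_zero_of_pow_mul_le {β x : ℝ} (hβ : 1 < β) (h : ∀ n : ℕ, β ^ n * |x| ≤ 1) : x = 0 := by
  by_contra hx
  have hx := abs_pos.2 hx
  obtain ⟨n, hn⟩ := pow_unbounded_of_one_lt |x|⁻¹ hβ
  rw [inv_lt_iff_one_lt_mul₀ hx] at hn
  have := h n
  nlinarith

/-- The orbit of `1` which computes `d_β(1)`. -/
lemma exists_orbit_dOne {β : ℝ} (hβ : 1 < β) :
    ∃ g : ℕ → ℝ, g 0 = 1 ∧ (∀ i, β * g i = dOne β i + g (i + 1)) ∧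
      (∀ i, 0 ≤ g i ∧ g i ≤ 1) ∧ ∀ i, 0 ≤ dOne β i := by
  by_cases hb : ∃ b : ℤ, β = b
  · have hd : ∀ i, dOne β i = ⌈β⌉ - 1 := fun i => by simp [dOne, hb]
    obtain ⟨b, rfl⟩ := hb
    have h1 : (1 : ℤ) < b := by exact_mod_cast hβ
    refine ⟨fun _ => 1, rfl, fun i => ?_, fun i => by norm_num, fun i => ?_⟩
    · rw [hd, Int.ceil_intCast]; push_cast; ring
    · rw [hd, Int.ceil_intCast]; omega
  · have h0 := zero_lt_one.trans hβ
    set T : ℝ → ℝ := fun y => Int.fract (β * y) with hT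
    set x : ℝ := 1 - ((⌈β⌉ - 1 : ℤ) : ℝ) / β with hx
    have hd0 : dOne β 0 = ⌈β⌉ - 1 := by simp [dOne]
    have hd : ∀ i, dOne β (i + 1) = ⌊β * T^[i + 1] x⌋ := fun i => by
      simp [dOne, hb, betaExpansion, hT, hx]
    have hT1 : T^[1] x = β - (⌈β⌉ - 1 : ℤ) := by
      have e : β * x = β - (⌈β⌉ - 1 : ℤ) := by rw [hx]; field_simp
      rw [Function.iterate_one, hT]
      simp only [e]
      rw [Int.fract_eq_self]
      have h1 := Int.le_ceil β
      have h2 := Int.ceil_lt_add_one β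
      have h3 : β ≠ ⌈β⌉ := fun h => hb ⟨_, h⟩
      have h4 := lt_of_le_of_ne h1 h3
      push_cast
      constructor <;> linarith
    have hTn : ∀ i, 0 ≤ T^[i + 1] x ∧ T^[i + 1] x ≤ 1 := fun i => by
      rw [Function.iterate_succ_apply']
      exact ⟨Int.fract_nonneg _, (Int.fract_lt_one _).le⟩
    refine ⟨fun i => if i = 0 then 1 else T^[i] x, if_pos rfl, fun i => ?_, fun i => ?_,
      fun i => ?_⟩
    · beta_reduce
      rcases i with _ | i
      · rw [if_pos rfl, if_neg (by omega), hd0, zero_add, hT1]; ring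
      · rw [if_neg (by omega), if_neg (by omega), hd, Function.iterate_succ_apply' T (i + 1)]
        exact (Int.floor_add_fract _).symm
    · rcases i with _ | i
      · norm_num
      · simpa using hTn i
    · rcases i with _ | i
      · rw [hd0]
        have : 0 < ⌈β⌉ := Int.ceil_pos.2 h0
        omega
      · rw [hd]
        exact Int.floor_nonneg.2 (mul_nonneg h0.le (hTn i).1)

lemma exists_pos_le_of_periodic {r : ℕ → ℝ} (hr : ∀ i, 0 < r i) {m k : ℕ} (hk : 0 < k)
    (h : ∀ i, m ≤ i → r (i + k) = r i) : ∃ δ, 0 < δ ∧ ∀ i, δ ≤ r i := by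
  obtain ⟨j, -, hj⟩ := Finset.exists_min_image (Finset.range (m + k)) r ⟨0, by simp; omega⟩
  refine ⟨r j, hr j, fun i => ?_⟩
  induction i using Nat.strong_induction_on with
  | _ i ih =>
    by_cases hi : i < m + k
    · exact hj i (Finset.mem_range.2 hi)
    · rw [show i = i - k + k by omega, h (i - k) (by omega)]
      exact ih _ (by omega)

lemma tailSeq_add (U t : ℕ → ℤ) (j a l : ℕ) : tailSeq U t j (a + l) =
    ∑ i ∈ Finset.range a, t (j + i) * U (a + l - 1 - i) + tailSeq U t (j + a) l := by
  rw [tailSeq_eq_sum, tailSeq_eq_sum, Finset.sum_range_add]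
  rw [Finset.sum_congr (s₁ := Finset.range l) rfl fun i _ => by
    rw [← add_assoc, show a + l - 1 - (a + i) = l - 1 - i by omega]]
  ring

lemma tailSeq_congr (U : ℕ → ℤ) {t : ℕ → ℤ} {j k : ℕ} (h : ∀ i, t (j + i) = t (k + i)) (l : ℕ) :
    tailSeq U t j l = tailSeq U t k l := by
  simp only [tailSeq_eq_sum, h]

/-- For `t = t₁ ⋯ t_m 0^ω`, the quasi-greedy expansion is `(t₁ ⋯ t_{m-1} (t_m - 1))^ω`. -/
lemma seqFinite_eq_tailSeq (t : ℕ → ℤ) {m : ℕ} (hm : 0 < m) (n : ℕ) :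
    seqFinite t m n =
      tailSeq (seqFinite t m) (fun i => t (i % m) - if i % m + 1 = m then 1 else 0) 0 n := by
  induction n using Nat.strong_induction_on with
  | _ n ih =>
    by_cases hn : n < m
    · rw [seqFinite, if_pos hn, tailSeq_eq_sum, Finset.sum_range]
      congr 1
      refine Finset.sum_congr rfl fun i _ => ?_
      have hi : (i : ℕ) < n := i.2
      rw [zero_add, Nat.mod_eq_of_lt (by omega), if_neg (by omega), sub_zero]
    · obtain ⟨l, rfl⟩ := Nat.exists_eq_add_of_le (not_lt.1 hn)
      rw [tailSeq_add, tailSeq_congr _ (k := 0) (fun i => by simp), ← ih l (by omega), seqFinite,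
        if_neg hn, ← Finset.sum_range (f := fun i => t i * seqFinite t m (m + l - 1 - i))]
      obtain ⟨a, rfl⟩ := Nat.exists_eq_add_of_le' hm
      rw [Finset.sum_range_succ, Finset.sum_range_succ]
      rw [Finset.sum_congr rfl fun i hi => by
        have hi := Finset.mem_range.1 hi
        rw [show t i = t ((0 + i) % (a + 1)) - if (0 + i) % (a + 1) + 1 = a + 1 then 1 else 0 by
          rw [zero_add, Nat.mod_eq_of_lt (by omega), if_neg (by omega), sub_zero]]]
      rw [zero_add a, Nat.mod_eq_of_lt (Nat.lt_succ_self a), if_pos rfl,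
        show a + 1 + l - 1 - a = l by omega]
      ring

/-- In the recurrence of the infinite case, the expansion `t` itself is the quasi-greedy one. -/
lemma seqPeriodic_eq_tailSeq {t : ℕ → ℤ} {m k : ℕ} (h : HasPeriod t m k) (n : ℕ) :
    seqPeriodic t m k n = tailSeq (seqPeriodic t m k) t 0 n := by
  induction n using Nat.strong_induction_on with
  | _ n ih =>
    by_cases hn : n < m + k
    · rw [seqPeriodic, if_pos hn, tailSeq_eq_sum, Finset.sum_range]
      simp only [zero_add]
    · obtain ⟨l, rfl⟩ := Nat.exists_eq_add_of_le (not_lt.1 hn)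
      have hk := h.1
      have e1 := ih (m + l) (by omega)
      rw [tailSeq_add] at e1
      rw [tailSeq_add, seqPeriodic, if_neg hn, if_pos hk,
        ← Finset.sum_range (f := fun i => t i * seqPeriodic t m k (m + k + l - 1 - i)),
        ← Finset.sum_range (f := fun i => t i * seqPeriodic t m k (m + k + l - k - 1 - i)),
        show m + k + l - k = m + l by omega, e1, tailSeq_congr _ (j := 0 + (m + k)) (k := 0 + m)
          fun i => by
            rw [show 0 + (m + k) + i = (m + i) + k by ring, h.2 _ (by omega), zero_add]]
      simp only [zero_add]
      ring

/-- The sequence `U_β` is attached to the quasi-greedy expansion of `1`, and the orbit of `1` stays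
away from `0`. -/
lemma IsParry.exists_isParryBertrand {β : ℝ} (hβ : IsParry β) :
    ∃ t r δ, IsParryBertrand β (U β) t r ∧ 0 < δ ∧ ∀ j : ℕ, δ ≤ r j := by
  obtain ⟨hβ, hper⟩ := hβ
  have hβ0 := zero_lt_one.trans hβ
  obtain ⟨g, g0, gs, gb, hd⟩ := exists_orbit_dOne hβ
  have hzero : ∀ i, g i = 0 → ∀ j, i ≤ j → dOne β j = 0 := by
    have hz : ∀ i, g i = 0 → dOne β i = 0 ∧ g (i + 1) = 0 := fun i hi => by
      have h1 := gs i
      have h2 : (0 : ℝ) ≤ dOne β i := by exact_mod_cast hd i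
      have h3 := (gb (i + 1)).1
      rw [hi, mul_zero] at h1
      have h4 : (dOne β i : ℝ) = 0 := by linarith
      exact ⟨by exact_mod_cast h4, by linarith⟩
    intro i hi j hij
    have : g j = 0 := by
      induction j, hij using Nat.le_induction with
      | base => exact hi
      | succ j _ ih => exact (hz j ih).2
    exact (hz j this).1
  by_cases hfin : IsFinite (dOne β)
  · have hU : U β = seqFinite (dOne β) (finLength (dOne β)) := by simp [U, hfin]
    set m := finLength (dOne β) with hm
    have hm0 : ∀ i, m ≤ i → dOne β i = 0 := Nat.sInf_mem hfin
    have hmpos : 0 < m := by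
      by_contra! h
      have h1 := gs 0
      rw [hm0 0 h, g0] at h1
      have := (gb (0 + 1)).2
      norm_num at h1 this
      linarith
    have hgm : g m = 0 := by
      refine eq_zero_of_pow_mul_le hβ fun n => ?_
      have : β ^ n * g m = g (m + n) := by
        induction n with
        | zero => simp
        | succ n ih =>
          have := gs (m + n)
          rw [hm0 _ (by omega), Int.cast_zero, zero_add] at this
          rw [pow_succ', mul_assoc, ih, this, add_assoc]
      rw [abs_of_nonneg (gb m).1, this]
      exact (gb _).2
    -- The orbit reaches `0` at time `m`; the quasi-greedy orbit restarts from `1` at that time.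
    have hgpos : ∀ i, i < m → 0 < g i := fun i hi => by
      refine lt_of_le_of_ne (gb i).1 fun h => ?_
      have : m ≤ i := Nat.sInf_le (hzero i h.symm)
      omega
    have hpos : ∀ i, 0 < g (i % m) := fun i => hgpos _ (Nat.mod_lt _ hmpos)
    obtain ⟨δ, hδ0, hδ⟩ := exists_pos_le_of_periodic hpos hmpos (m := 0) fun i _ => by
      rw [Nat.add_mod_right]
    refine ⟨fun i => dOne β (i % m) - if i % m + 1 = m then 1 else 0, fun i => g (i % m), δ,
      ⟨⟨hβ, by rw [Nat.zero_mod, g0], hpos, fun i => (gb _).2, fun i => ?_⟩, fun n => ?_⟩, hδ0, hδ⟩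
    · have hi := Nat.mod_lt i hmpos
      rw [gs, ← Nat.mod_add_mod]
      split_ifs with h
      · rw [h, Nat.mod_self, hgm, g0]; push_cast; ring
      · rw [Nat.mod_eq_of_lt (a := i % m + 1) (by omega)]; push_cast; ring
    · rw [hU]
      exact seqFinite_eq_tailSeq _ hmpos n
  · have hU : U β = seqPeriodic (dOne β) (preperiod (dOne β)) (period (dOne β)) := by
      simp [U, hfin]
    have h1 : ∃ k, HasPeriod (dOne β) (preperiod (dOne β)) k :=
      Nat.sInf_mem (s := {m | ∃ k, HasPeriod (dOne β) m k}) hper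
    have h2 : HasPeriod (dOne β) (preperiod (dOne β)) (period (dOne β)) :=
      Nat.sInf_mem (s := {k | HasPeriod (dOne β) (preperiod (dOne β)) k}) h1
    set m := preperiod (dOne β)
    set k := period (dOne β)
    have hpos : ∀ i, 0 < g i := fun i =>
      lt_of_le_of_ne (gb i).1 fun h => hfin ⟨i, hzero i h.symm⟩
    obtain ⟨δ, hδ0, hδ⟩ := exists_pos_le_of_periodic hpos h2.1 (m := m) fun i hi => by
      refine sub_eq_zero.1 (eq_zero_of_pow_mul_le hβ fun n => ?_)
      have : β ^ n * (g (i + k) - g i) = g (i + n + k) - g (i + n) := by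
        induction n with
        | zero => simp
        | succ n ih =>
          rw [pow_succ', mul_assoc, ih, mul_sub, gs, gs, h2.2 _ (by omega)]
          rw [show i + (n + 1) + k = i + n + k + 1 by ring, ← add_assoc]
          ring
      rw [← abs_of_pos (pow_pos hβ0 n), ← abs_mul, this, abs_le]
      have a1 := gb (i + n + k)
      have a2 := gb (i + n)
      constructor <;> linarith [a1.1, a1.2, a2.1, a2.2]
    refine ⟨dOne β, g, δ, ⟨⟨hβ, g0, hpos, fun i => (gb i).2, gs⟩, fun n => ?_⟩, hδ0, hδ⟩
    rw [hU]
    exact seqPeriodic_eq_tailSeq h2 n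

/-! ### Growth of the numeration system -/

lemma tendsto_sum_mul_of_tendsto {l : Filter ℕ} (hl : l ≤ atTop) {g b : ℕ → ℝ} {a : ℕ → ℕ → ℝ}
    {C : ℝ} (hg0 : ∀ j, 0 ≤ g j) (hg : Summable g) (ha : ∀ n j, |a n j| ≤ C)
    (hab : ∀ j, Tendsto (fun n => a n j) l (𝓝 (b j))) {N : ℕ → ℕ} (hN : ∀ n, n ≤ N n) :
    Tendsto (fun n => ∑ j ∈ Finset.range (N n), g j * a n j) l (𝓝 (∑' j, g j * b j)) := by
  have e : ∀ n, ∑ j ∈ Finset.range (N n), g j * a n j =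
      ∑' j, if j < N n then g j * a n j else 0 := fun n => by
    rw [tsum_eq_sum (s := Finset.range (N n))]
    · exact Finset.sum_congr rfl fun j hj => (if_pos (Finset.mem_range.1 hj)).symm
    · exact fun j hj => if_neg fun h => hj (Finset.mem_range.2 h)
  simp only [e]
  refine tendsto_tsum_of_dominated_convergence (hg.mul_right C) (fun j => ?_)
    (Eventually.of_forall fun n j => ?_)
  · refine ((hab j).const_mul (g j)).congr' ?_
    filter_upwards [hl (eventually_gt_atTop j)] with n hn
    exact (if_pos (hn.trans_le (hN n))).symm
  · have hC := (abs_nonneg _).trans (ha n j)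
    split_ifs
    · rw [Real.norm_eq_abs, abs_mul, abs_of_nonneg (hg0 j)]
      exact mul_le_mul_of_nonneg_left (ha n j) (hg0 j)
    · rw [norm_zero]; exact mul_nonneg (hg0 j) hC

lemma exists_tendsto_of_abs_le {a : ℕ → ℝ} {C : ℝ} (ha : ∀ n, |a n| ≤ C) (G : Ultrafilter ℕ) :
    ∃ x, Tendsto a G (𝓝 x) := by
  obtain ⟨x, -, hx⟩ := (isCompact_Icc (a := -C) (b := C)).ultrafilter_le_nhds (G.map a) (by
    simp only [le_principal_iff]
    exact Eventually.of_forall (f := (G : Filter ℕ)) fun n => abs_le.1 (ha n))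
  exact ⟨x, hx⟩

lemma tendsto_tsub_ultrafilter {G : Ultrafilter ℕ} (hG : (G : Filter ℕ) ≤ atTop) (j : ℕ) :
    ((G.map fun n => n - j : Ultrafilter ℕ) : Filter ℕ) ≤ atTop :=
  ((tendsto_sub_atTop_nat j).mono_left hG :)

/-- Maximum principle for a renewal equation: along an ultrafilter which realises the largest
cluster value `x` of `a`, the sequence shifted by one also tends to `x`. -/
lemma tendsto_pred_of_renewal {f a e : ℕ → ℝ} {C x : ℝ} (hf0 : ∀ i, 0 ≤ f i) (hf : HasSum f 1)
    (hf1 : 0 < f 0) (ha : ∀ n, |a n| ≤ C) (he : Tendsto e atTop (𝓝 0))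
    (hae : ∀ n, a n = ∑ i ∈ Finset.range n, f i * a (n - 1 - i) + e n)
    (hx : ∀ G : Ultrafilter ℕ, (G : Filter ℕ) ≤ atTop → ∀ y, Tendsto a G (𝓝 y) → y ≤ x)
    {G : Ultrafilter ℕ} (hG : (G : Filter ℕ) ≤ atTop) (hGx : Tendsto a G (𝓝 x)) :
    Tendsto (fun n => a (n - 1)) G (𝓝 x) := by
  choose b hb using fun i => exists_tendsto_of_abs_le (a := fun n => a (n - 1 - i))
    (fun n => ha _) G
  have hbx : ∀ i, b i ≤ x := fun i => by
    refine hx (G.map fun n => n - (1 + i)) (tendsto_tsub_ultrafilter hG _) _ ?_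
    have := hb i
    simp only [Nat.sub_sub] at this
    exact this
  have h1 := tendsto_sum_mul_of_tendsto hG hf0 hf.summable (a := fun n i => a (n - 1 - i))
    (fun n i => ha _) hb (N := id) (fun n => le_rfl)
  have h2 := h1.add (he.mono_left hG)
  have h3 : x = ∑' i, f i * b i := by
    refine tendsto_nhds_unique hGx ?_
    rw [add_zero] at h2
    exact h2.congr fun n => (hae n).symm
  have hbC : ∀ i, |b i| ≤ C := fun i =>
    le_of_tendsto (hb i).abs (Eventually.of_forall fun n => ha _)
  have hs1 : Summable fun i => f i * b i := by
    refine Summable.of_norm_bounded (hf.summable.mul_right C) fun i => ?_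
    rw [Real.norm_eq_abs, abs_mul, abs_of_nonneg (hf0 i)]
    exact mul_le_mul_of_nonneg_left (hbC i) (hf0 i)
  -- The average of the `b i ≤ x` with the weights `f i` is `x`, so `b 0 = x` because `0 < f 0`.
  have h4 : HasSum (fun i => f i * x - f i * b i) (1 * x - x) := by
    have := (hf.mul_right x).sub hs1.hasSum
    rwa [← h3] at this
  rw [one_mul, sub_self] at h4
  have h5 := (hasSum_zero_iff_of_nonneg fun i => by
    have := mul_le_mul_of_nonneg_left (hbx i) (hf0 i)
    simpa using this).1 h4
  have h6 : b 0 = x := by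
    have := congrFun h5 0
    simp only [Pi.zero_apply, ← mul_sub] at this
    rcases mul_eq_zero.1 this with h | h <;> linarith
  rw [← h6]
  exact hb 0

/-- Iterated form of `tendsto_pred_of_renewal`. -/
lemma tendsto_sub_of_renewal {f a e : ℕ → ℝ} {C x : ℝ} (hf0 : ∀ i, 0 ≤ f i) (hf : HasSum f 1)
    (hf1 : 0 < f 0) (ha : ∀ n, |a n| ≤ C) (he : Tendsto e atTop (𝓝 0))
    (hae : ∀ n, a n = ∑ i ∈ Finset.range n, f i * a (n - 1 - i) + e n)
    (hx : ∀ G : Ultrafilter ℕ, (G : Filter ℕ) ≤ atTop → ∀ y, Tendsto a G (𝓝 y) → y ≤ x)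
    {G : Ultrafilter ℕ} (hG : (G : Filter ℕ) ≤ atTop) (hGx : Tendsto a G (𝓝 x)) (j : ℕ) :
    Tendsto (fun n => a (n - j)) G (𝓝 x) := by
  induction j with
  | zero => exact hGx
  | succ j ih =>
    have := tendsto_pred_of_renewal hf0 hf hf1 ha he hae hx
      (G := G.map fun n => n - j) (tendsto_tsub_ultrafilter hG j) ih
    rw [Ultrafilter.coe_map, tendsto_map'_iff] at this
    exact this

/-- Renewal theorem. The conserved quantity `∑ g_j a_{n-j}` identifies the limit of the sequence
with its largest cluster value and with its smallest one. -/
lemma tendsto_of_renewal {f a e g s : ℕ → ℝ} {C B : ℝ} (hf0 : ∀ i, 0 ≤ f i) (hf : HasSum f 1)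
    (hf1 : 0 < f 0) (ha : ∀ n, |a n| ≤ C) (he : Tendsto e atTop (𝓝 0))
    (hae : ∀ n, a n = ∑ i ∈ Finset.range n, f i * a (n - 1 - i) + e n)
    (hg0 : ∀ j, 0 ≤ g j) (hg : Summable g) (hg1 : 0 < ∑' j, g j) (hs : Tendsto s atTop (𝓝 B))
    (hgs : ∀ n, ∑ j ∈ Finset.range (n + 1), g j * a (n - j) = s n) :
    Tendsto a atTop (𝓝 (B / ∑' j, g j)) := by
  have hid : ∀ (G : Ultrafilter ℕ), (G : Filter ℕ) ≤ atTop → ∀ x,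
      (∀ j, Tendsto (fun n => a (n - j)) G (𝓝 x)) → x = B / ∑' j, g j := by
    intro G hG x hx
    have h1 := tendsto_sum_mul_of_tendsto hG hg0 hg (a := fun n j => a (n - j))
      (fun n j => ha _) hx (N := fun n => n + 1) (fun n => n.le_succ)
    rw [eq_div_iff hg1.ne', mul_comm, ← tsum_mul_right]
    exact tendsto_nhds_unique h1 ((hs.mono_left hG).congr fun n => (hgs n).symm)
  set S : Set ℝ := {x | MapClusterPt x atTop a} with hS
  have hSG : ∀ x, x ∈ S ↔ ∃ G : Ultrafilter ℕ, (G : Filter ℕ) ≤ atTop ∧ Tendsto a G (𝓝 x) :=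
    fun x => mapClusterPt_iff_ultrafilter
  have hSne : S.Nonempty := by
    obtain ⟨x, hx⟩ := exists_tendsto_of_abs_le ha (hyperfilter ℕ)
    exact ⟨x, (hSG x).2 ⟨_, Nat.hyperfilter_le_atTop, hx⟩⟩
  have hSc : IsCompact S := by
    refine (isCompact_Icc (a := -C) (b := C)).of_isClosed_subset isClosed_setOfPred_clusterPt ?_
    intro x hx
    obtain ⟨G, -, hG⟩ := (hSG x).1 hx
    exact isClosed_Icc.mem_of_tendsto hG (Eventually.of_forall fun n => abs_le.1 (ha n))
  obtain ⟨x, hxS, hx⟩ := hSc.exists_isGreatest hSne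
  obtain ⟨y, hyS, hy⟩ := hSc.exists_isLeast hSne
  have ex : x = B / ∑' j, g j := by
    obtain ⟨G, hG, hGx⟩ := (hSG x).1 hxS
    exact hid G hG x (tendsto_sub_of_renewal hf0 hf hf1 ha he hae
      (fun G' hG' z hz => hx ((hSG z).2 ⟨G', hG', hz⟩)) hG hGx)
  have ey : y = B / ∑' j, g j := by
    obtain ⟨G, hG, hGx⟩ := (hSG y).1 hyS
    refine hid G hG y fun j => ?_
    -- The opposite sequence turns the smallest cluster value into the largest one.
    have := tendsto_sub_of_renewal (a := fun n => -a n) (e := fun n => -e n) (x := -y) hf0 hf hf1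
      (fun n => by rw [abs_neg]; exact ha n) (by simpa using he.neg)
      (fun n => by rw [hae n]; simp only [mul_neg, Finset.sum_neg_distrib]; ring)
      (fun G' hG' z hz => by
        have := hy ((hSG (-z)).2 ⟨G', hG', by simpa using hz.neg⟩)
        linarith) hG hGx.neg j
    simpa using this.neg
  rw [tendsto_iff_ultrafilter]
  intro G hG
  obtain ⟨z, hz⟩ := exists_tendsto_of_abs_le ha G
  have hzS := (hSG z).2 ⟨G, hG, hz⟩
  have : z = B / ∑' j, g j := le_antisymm ((hx hzS).trans_eq ex) (ey.symm.trans_le (hy hzS))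
  rw [← this]
  exact hz

namespace IsParryBertrand

variable {β : ℝ} {U t : ℕ → ℤ} {r : ℕ → ℝ}

/-- The conserved quantity of the renewal equation of `U`. -/
lemma sum_orbit_mul (H : IsParryBertrand β U t r) (n : ℕ) :
    ∑ j ∈ Finset.range (n + 1), r j * U (n - j) = ∑ k ∈ Finset.range (n + 1), β ^ k := by
  induction n with
  | zero => simp [H.zero, H.U_zero]
  | succ n ih =>
    rw [geom_sum_succ, ← ih, Finset.sum_range_succ', H.zero, H.eq_tailSeq (n + 1 - 0),
      tailSeq_eq_sum]
    push_cast
    have e : ∀ j, r (j + 1) * (U (n - j) : ℝ) =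
        β * (r j * U (n - j)) - t (0 + j) * U (n - j) := fun j => by
      rw [show r (j + 1) = β * r j - t j by rw [H.step]; ring, zero_add]
      ring
    simp only [e, Finset.sum_sub_distrib, Finset.mul_sum]
    ring

lemma exists_tendsto_div_pow (H : IsParryBertrand β U t r) :
    ∃ γ : ℝ, 0 < γ ∧ Tendsto (fun n => (U n : ℝ) / β ^ n) atTop (𝓝 γ) := by
  have hβ := zero_lt_one.trans H.one_lt
  have hi1 : β⁻¹ < 1 := inv_lt_one_of_one_lt₀ H.one_lt
  have hi0 : 0 < β⁻¹ := inv_pos.2 hβ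
  -- `g j` is the tail `∑_{i ≥ j} f i` of the weights `f i = t i / β ^ (i + 1)`.
  set g : ℕ → ℝ := fun j => r j / β ^ j with hg
  have hgle : ∀ j, g j ≤ β⁻¹ ^ j := fun j => by
    rw [hg, inv_pow, ← one_div]
    have := H.le_one j
    simp only
    gcongr
  have hgpos : ∀ j, 0 < g j := fun j => div_pos (H.pos j) (by positivity)
  have hgs : Summable g := Summable.of_nonneg_of_le (fun j => (hgpos j).le) hgle
    (summable_geometric_of_lt_one hi0.le hi1)
  have hga : ∀ n, ∑ j ∈ Finset.range (n + 1), g j * ((U (n - j) : ℝ) / β ^ (n - j)) =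
      ∑ k ∈ Finset.range (n + 1), β⁻¹ ^ k := fun n => by
    have h1 : ∀ j ∈ Finset.range (n + 1), g j * ((U (n - j) : ℝ) / β ^ (n - j)) =
        r j * U (n - j) / β ^ n := fun j hj => by
      have hj := Finset.mem_range.1 hj
      rw [hg, div_mul_div_comm, ← pow_add, show j + (n - j) = n by omega]
    rw [Finset.sum_congr rfl h1, ← Finset.sum_div, H.sum_orbit_mul, ← Finset.sum_range_reflect,
      Finset.sum_div]
    refine Finset.sum_congr rfl fun j hj => ?_
    have hj := Finset.mem_range.1 hj
    rw [div_eq_iff (by positivity), inv_pow, inv_mul_eq_div, eq_div_iff (by positivity), ← pow_add]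
    congr 1
    omega
  have hgeo := hasSum_geometric_of_lt_one hi0.le hi1
  have hapos : ∀ n, 0 < (U n : ℝ) / β ^ n := fun n =>
    div_pos (by exact_mod_cast H.U_pos n) (by positivity)
  have hab : ∀ n, |(U n : ℝ) / β ^ n| ≤ (1 - β⁻¹)⁻¹ := fun n => by
    rw [abs_of_pos (hapos n)]
    have h1 : g 0 * ((U (n - 0) : ℝ) / β ^ (n - 0)) ≤
        ∑ j ∈ Finset.range (n + 1), g j * ((U (n - j) : ℝ) / β ^ (n - j)) :=
      Finset.single_le_sum (f := fun j => g j * ((U (n - j) : ℝ) / β ^ (n - j)))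
        (fun j _ => (mul_pos (hgpos j) (hapos _)).le) (by simp)
    rw [hga] at h1
    have h2 := sum_le_hasSum (Finset.range (n + 1)) (fun j _ => by positivity) hgeo
    simp only [hg, H.zero, pow_zero, div_one, one_mul, Nat.sub_zero] at h1
    exact h1.trans h2
  have hf : HasSum (fun i => (t i : ℝ) / β ^ (i + 1)) 1 := by
    rw [hasSum_iff_tendsto_nat_of_nonneg fun i =>
      div_nonneg (by exact_mod_cast H.digit_nonneg i) (by positivity)]
    have h1 : ∀ n, ∑ i ∈ Finset.range n, (t i : ℝ) / β ^ (i + 1) = 1 - g n := fun n => by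
      induction n with
      | zero => simp [hg, H.zero]
      | succ n ih =>
        have h2 : (t n : ℝ) = β * r n - r (n + 1) := by rw [H.step]; ring
        rw [Finset.sum_range_succ, ih, hg, h2]
        simp only
        rw [pow_succ]
        field_simp
        ring
    simp only [h1]
    simpa using hgs.tendsto_atTop_zero.const_sub 1
  refine ⟨(1 - β⁻¹)⁻¹ / ∑' j, g j, div_pos (inv_pos.2 (by linarith))
    (hgs.tsum_pos (fun j => (hgpos j).le) 0 (hgpos 0)), ?_⟩
  refine tendsto_of_renewal (a := fun n => (U n : ℝ) / β ^ n) (e := fun n => β⁻¹ ^ n)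
    (fun i => div_nonneg (by exact_mod_cast H.digit_nonneg i) (by positivity)) hf
    (div_pos (by exact_mod_cast H.one_le_digit_zero) (by positivity)) hab
    (tendsto_pow_atTop_nhds_zero_of_lt_one hi0.le hi1) (fun n => ?_) (fun j => (hgpos j).le) hgs
    (hgs.tsum_pos (fun j => (hgpos j).le) 0 (hgpos 0))
    (s := fun n => ∑ k ∈ Finset.range (n + 1), β⁻¹ ^ k)
    ((tendsto_add_atTop_iff_nat 1).2 hgeo.tendsto_sum_nat) hga
  rw [H.eq_tailSeq n, tailSeq_eq_sum]
  push_cast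
  rw [add_div, Finset.sum_div, inv_pow, one_div]
  congr 1
  refine Finset.sum_congr rfl fun i hi => ?_
  have hi := Finset.mem_range.1 hi
  rw [zero_add, div_mul_div_comm, ← pow_add, show i + 1 + (n - 1 - i) = n by omega]

lemma tendsto_U (H : IsParryBertrand β U t r) : Tendsto (fun n => (U n : ℝ)) atTop atTop := by
  obtain ⟨γ, hγ, h⟩ := H.exists_tendsto_div_pow
  have hβ := zero_lt_one.trans H.one_lt
  refine (h.pos_mul_atTop hγ (tendsto_pow_atTop_atTop_of_one_lt H.one_lt)).congr fun n => ?_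
  field_simp

lemma tendsto_ratio (H : IsParryBertrand β U t r) :
    Tendsto (fun n => (U n : ℝ) / U (n + 1)) atTop (𝓝 (1 / β)) := by
  obtain ⟨γ, hγ, h⟩ := H.exists_tendsto_div_pow
  have hβ := zero_lt_one.trans H.one_lt
  have h1 := (h.div ((tendsto_add_atTop_iff_nat 1).2 h) hγ.ne').div_const β
  rw [div_self hγ.ne'] at h1
  refine h1.congr fun n => ?_
  have : (U (n + 1) : ℝ) ≠ 0 := by exact_mod_cast (H.U_pos (n + 1)).ne'
  simp only [Pi.div_apply]
  rw [pow_succ]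
  field_simp

/-- The error made in replacing `val w / U |w|` by `0.w`, when only the `J` leading digits are taken
into account. -/
lemma exists_abs_val_div_sub_le_pow_add (H : IsParryBertrand β U t r) (J : ℕ) {ε : ℝ} (hε : 0 < ε) :
    ∃ N, ∀ w, IsAdmissible β w → N ≤ w.length →
      |(val U w : ℝ) / U w.length - realVal β w| ≤ 1 / β ^ J + ε := by
  have hβ := zero_lt_one.trans H.one_lt
  have hU : ∀ n, (0 : ℝ) < U n := fun n => by exact_mod_cast H.U_pos n
  have hv : ∀ w, IsAdmissible β w → 0 ≤ (val U w : ℝ) / U w.length ∧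
      (val U w : ℝ) / U w.length ≤ 1 := fun w hw => by
    have hw := H.isGreedy_iff.2 hw
    refine ⟨div_nonneg (by exact_mod_cast hw.val_nonneg H.U_pos) (hU _).le, ?_⟩
    rw [div_le_one (hU _)]
    exact_mod_cast (hw.val_lt H.U_pos).le
  induction J with
  | zero =>
    refine ⟨0, fun w hw _ => ?_⟩
    have h1 := hv w hw
    have h2 := hw.realVal_nonneg H.one_lt
    have h3 := hw.realVal_lt_one
    rw [pow_zero, div_one, abs_le]
    constructor <;> linarith [h1.1, h1.2]
  | succ J ih =>
    obtain ⟨N, hN⟩ := ih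
    have hη : 0 < (ε - ε / β) / (β + 1) := by
      have : ε / β < ε := div_lt_self hε H.one_lt
      exact div_pos (by linarith) (by linarith)
    obtain ⟨M, hM⟩ := eventually_atTop.1 (H.tendsto_ratio.eventually (Metric.ball_mem_nhds _ hη))
    refine ⟨N + M + 1, fun w hw hl => ?_⟩
    cases w with
    | nil => simp at hl
    | cons d w =>
      rw [List.length_cons] at hl ⊢
      have h1 := hN w hw.2.1 (by omega)
      have h2 := hM w.length (by omega)
      rw [Real.dist_eq] at h2
      have h3 := hv w hw.2.1
      have h4 := hw.digit_le H.one_lt (d := d) (by simp)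
      have h5 : (d : ℝ) < β := Int.lt_ceil.1 (by omega)
      have h6 : (0 : ℝ) ≤ d := by exact_mod_cast h4.1
      set ρ : ℝ := (U w.length : ℝ) / U (w.length + 1) with hρ
      set x : ℝ := (val U w : ℝ) / U w.length with hx
      have e : (val U (d :: w) : ℝ) / U (w.length + 1) - realVal β (d :: w) =
          (d + x) * (ρ - 1 / β) + (x - realVal β w) / β := by
        have := (hU w.length).ne'
        have := (hU (w.length + 1)).ne'
        rw [val, realVal, hρ, hx]
        push_cast
        field_simp
        ring
      rw [e]
      refine (abs_add_le _ _).trans ?_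
      rw [abs_mul, abs_div, abs_of_pos hβ, abs_of_nonneg (by linarith [h3.1])]
      have h7 : (d + x) * |ρ - 1 / β| ≤ (β + 1) * ((ε - ε / β) / (β + 1)) := by
        have := h3.2
        gcongr
      rw [mul_div_cancel₀ _ (by linarith)] at h7
      have h8 : |x - realVal β w| / β ≤ (1 / β ^ J + ε) / β := by gcongr
      rw [add_div, div_div, ← pow_succ] at h8
      linarith

/-- The normalised values of the greedy words of length `n` approach their real values, uniformly
as `n` tends to infinity. -/
lemma exists_abs_val_div_sub_le (H : IsParryBertrand β U t r) {ε : ℝ} (hε : 0 < ε) :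
    ∃ N, ∀ w, IsAdmissible β w → N ≤ w.length →
      |(val U w : ℝ) / U w.length - realVal β w| ≤ ε := by
  obtain ⟨J, hJ⟩ := pow_unbounded_of_one_lt (2 / ε) H.one_lt
  obtain ⟨N, hN⟩ := H.exists_abs_val_div_sub_le_pow_add J (half_pos hε)
  refine ⟨N, fun w hw hl => (hN w hw hl).trans ?_⟩
  have : 1 / β ^ J ≤ ε / 2 := by
    rw [div_le_div_iff₀ (pow_pos (zero_lt_one.trans H.one_lt) _) two_pos]
    rw [div_lt_iff₀ hε] at hJ
    linarith
  linarith

end IsParryBertrand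

/-! ### Hausdorff convergence -/

/-- A criterion for the Hausdorff convergence of `A n` to `L`: by compactness of `L`, it is enough
to approach the points of a set whose closure contains `L` one at a time. -/
lemma tendsto_dist_nonemptyCompacts {X : Type*} [MetricSpace X] {A : ℕ → NonemptyCompacts X}
    {L : NonemptyCompacts X} {S : Set X} (hS : (L : Set X) ⊆ closure S)
    (h1 : ∀ ε > 0, ∀ᶠ n in atTop, ∀ x ∈ A n, ∃ y ∈ L, dist x y ≤ ε)
    (h2 : ∀ x ∈ S, ∀ ε > 0, ∀ᶠ n in atTop, ∃ y ∈ A n, dist x y ≤ ε) :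
    Tendsto (fun n => dist (A n) L) atTop (𝓝 0) := by
  rw [Metric.tendsto_atTop']
  intro ε hε
  obtain ⟨T, hTS, hTf, hT⟩ := L.isCompact.elim_finite_subcover_image (b := S)
    (c := fun x => Metric.ball x (ε / 4)) (fun _ _ => Metric.isOpen_ball) fun x hx => by
      obtain ⟨y, hy, hxy⟩ := Metric.mem_closure_iff.1 (hS hx) (ε / 4) (by linarith)
      exact Set.mem_iUnion₂.2 ⟨y, hy, hxy⟩
  have h3 : ∀ᶠ n in atTop, ∀ x ∈ T, ∃ y ∈ A n, dist x y ≤ ε / 4 :=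
    (eventually_all_finite hTf).2 fun x hx => h2 x (hTS hx) _ (by linarith)
  obtain ⟨N, hN⟩ := eventually_atTop.1 (h3.and (h1 (ε / 2) (by linarith)))
  refine ⟨N, fun n hn => ?_⟩
  obtain ⟨a1, a2⟩ := hN n hn.le
  rw [Real.dist_eq, sub_zero, abs_of_nonneg dist_nonneg, Metric.NonemptyCompacts.dist_eq]
  refine lt_of_le_of_lt (Metric.hausdorffDist_le_of_mem_dist (r := ε / 2) (by linarith) a2 ?_)
    (by linarith)
  intro x hx
  obtain ⟨z, hz, hxz⟩ := Set.mem_iUnion₂.1 (hT hx)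
  obtain ⟨y, hy, hzy⟩ := a1 z hz
  refine ⟨y, hy, (dist_triangle x z y).trans ?_⟩
  have := Metric.mem_ball.1 hxz
  linarith

lemma dist_le_abs_add_abs (x y x' y' : ℝ) :
    dist (!₂[x, y] : Plane) !₂[x', y'] ≤ |x - x'| + |y - y'| := by
  rw [EuclideanSpace.dist_eq, Real.sqrt_le_left (by positivity)]
  simp only [Fin.sum_univ_two, Real.dist_eq]
  simp only [Matrix.cons_val_zero, Matrix.cons_val_one]
  nlinarith [abs_nonneg (x - x'), abs_nonneg (y - y')]

lemma eq_toLp (q : Plane) : q = !₂[q 0, q 1] := by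
  ext i; fin_cases i <;> rfl

lemma isCompact_box (R : ℝ) : IsCompact {q : Plane | ∀ i, q i ∈ Set.Icc (0 : ℝ) R} := by
  refine Metric.isCompact_of_isClosed_isBounded ?_ ?_
  · have : {q : Plane | ∀ i, q i ∈ Set.Icc (0 : ℝ) R} =
        ⋂ i, (fun q : Plane => q i) ⁻¹' Set.Icc 0 R := by
      ext q; simp
    rw [this]
    exact isClosed_iInter fun i => isClosed_Icc.preimage (by fun_prop)
  · refine (Metric.isBounded_closedBall (x := (!₂[0, 0] : Plane)) (r := R + R)).subset ?_
    intro q hq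
    rw [Metric.mem_closedBall, eq_toLp q]
    refine (dist_le_abs_add_abs _ _ _ _).trans ?_
    rw [sub_zero, sub_zero, abs_of_nonneg (hq 0).1, abs_of_nonneg (hq 1).1]
    exact add_le_add (hq 0).2 (hq 1).2

/-! ### The sets `𝒰_n` -/

lemma mem_pascalSet {β : ℝ} {n : ℕ} {q : Plane} : q ∈ pascalSet β n ↔
    ∃ u ∈ language (U β), ∃ v ∈ language (U β), val (U β) u < U β n ∧ val (U β) v < U β n ∧
      Odd (binom u v) ∧ q ∈ ((U β n : ℝ)⁻¹) •
        ((!₂[(val (U β) v : ℝ), (val (U β) u : ℝ)] : Plane) +ᵥ unitSquare) := by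
  simp only [pascalSet, Set.smul_set_iUnion, Set.mem_iUnion, exists_prop]

lemma zero_mem_unitSquare : (0 : Plane) ∈ unitSquare := fun i => by simp

variable {β : ℝ} {t : ℕ → ℤ} {r : ℕ → ℝ}

lemma IsParryBertrand.isCompact_pascalSet (H : IsParryBertrand β (U β) t r) (n : ℕ) :
    IsCompact (pascalSet β n) := by
  have hF := finite_language_val_lt H.U_zero H.U_pos H.strictMono n
  have e : pascalSet β n = ⋃ a ∈ {a : List ℤ × List ℤ |
      (a ∈ {w | w ∈ language (U β) ∧ val (U β) w < U β n} ×ˢ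
        {w | w ∈ language (U β) ∧ val (U β) w < U β n}) ∧ Odd (binom a.1 a.2)},
      ((U β n : ℝ)⁻¹) •
        ((!₂[(val (U β) a.2 : ℝ), (val (U β) a.1 : ℝ)] : Plane) +ᵥ unitSquare) := by
    ext q
    rw [mem_pascalSet, Set.mem_iUnion₂]
    constructor
    · rintro ⟨u, hu, v, hv, h1, h2, h3, h4⟩
      exact ⟨(u, v), ⟨⟨⟨hu, h1⟩, ⟨hv, h2⟩⟩, h3⟩, h4⟩
    · rintro ⟨⟨u, v⟩, ⟨⟨⟨hu, h1⟩, ⟨hv, h2⟩⟩, h3⟩, h4⟩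
      exact ⟨u, hu, v, hv, h1, h2, h3, h4⟩
  rw [e]
  exact ((hF.prod hF).subset fun a ha => ha.1).isCompact_biUnion fun a _ =>
    ((isCompact_box 1).vadd _).smul _

lemma corner_mem_pascalSet {n : ℕ} {u v : List ℤ} (hu : u ∈ language (U β))
    (hv : v ∈ language (U β)) (hun : val (U β) u < U β n) (hvn : val (U β) v < U β n)
    (huv : Odd (binom u v)) :
    (!₂[(val (U β) v : ℝ) / U β n, (val (U β) u : ℝ) / U β n] : Plane) ∈ pascalSet β n := by
  refine mem_pascalSet.2 ⟨u, hu, v, hv, hun, hvn, huv, ?_⟩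
  refine ⟨_, ⟨0, zero_mem_unitSquare, rfl⟩, ?_⟩
  ext i
  fin_cases i <;> simp [div_eq_inv_mul]

lemma IsParryBertrand.exists_corner (H : IsParryBertrand β (U β) t r) {n : ℕ} {q : Plane}
    (hq : q ∈ pascalSet β n) : ∃ u ∈ language (U β), ∃ v ∈ language (U β),
      val (U β) u < U β n ∧ val (U β) v < U β n ∧ Odd (binom u v) ∧
      dist q !₂[(val (U β) v : ℝ) / U β n, (val (U β) u : ℝ) / U β n] ≤ 2 / U β n := by
  obtain ⟨u, hu, v, hv, h1, h2, h3, _, ⟨s, hs, rfl⟩, rfl⟩ := mem_pascalSet.1 hq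
  refine ⟨u, hu, v, hv, h1, h2, h3, ?_⟩
  have hU : (0 : ℝ) < U β n := by exact_mod_cast H.U_pos n
  have e : ((U β n : ℝ)⁻¹ • ((!₂[(val (U β) v : ℝ), (val (U β) u : ℝ)] : Plane) +ᵥ s) : Plane) =
      !₂[(val (U β) v + s 0) / U β n, (val (U β) u + s 1) / U β n] := by
    ext i
    fin_cases i <;> simp [div_eq_inv_mul, mul_add]
  have hs0 := hs 0
  have hs1 := hs 1
  simp only [e]
  refine (dist_le_abs_add_abs _ _ _ _).trans ?_
  rw [← sub_div, ← sub_div, add_sub_cancel_left, add_sub_cancel_left,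
    abs_of_nonneg (div_nonneg hs0.1 hU.le), abs_of_nonneg (div_nonneg hs1.1 hU.le), ← add_div]
  have : s 0 + s 1 ≤ 2 := by linarith [hs0.2, hs1.2]
  gcongr

/-! ### The sets `𝒜_n` -/

lemma iterate_c (β : ℝ) (i : ℕ) (q : Plane) : (c β)^[i] q = !₂[q 0 / β ^ i, q 1 / β ^ i] := by
  induction i with
  | zero => simpa using eq_toLp q
  | succ i ih =>
    rw [Function.iterate_succ_apply', ih, c]
    ext k
    fin_cases k <;> simp [pow_succ, div_eq_mul_inv, mul_comm, mul_assoc]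

lemma iterate_h (β : ℝ) (j : ℕ) (q : Plane) : (h β)^[j] q = !₂[q 0, β ^ j * q 1] := by
  induction j with
  | zero => simpa using eq_toLp q
  | succ j ih =>
    rw [Function.iterate_succ_apply', ih, h]
    ext k
    fin_cases k <;> simp [pow_succ', mul_assoc]

lemma iterate_h_iterate_c (β : ℝ) (i j : ℕ) (q : Plane) :
    (h β)^[j] ((c β)^[i] q) = !₂[q 0 / β ^ i, β ^ j * (q 1 / β ^ i)] := by
  rw [iterate_h, iterate_c]
  rfl

lemma continuous_iterate_h_iterate_c (β : ℝ) (i j : ℕ) :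
    Continuous fun q => (h β)^[j] ((c β)^[i] q) := by
  simp only [iterate_h_iterate_c]
  fun_prop

/-- The point `A_{u,v} + s (B_{u,v} - A_{u,v})` of the segment `S_{u,v}`. -/
noncomputable def segPoint (β : ℝ) (u v : List ℤ) (s : ℝ) : Plane :=
  !₂[realVal β v / β ^ (u.length - v.length) + s / β ^ (u.length + p β u v),
    realVal β u + s / β ^ (u.length + p β u v)]

lemma segment_eq_image_segPoint (β : ℝ) (u v : List ℤ) :
    segment ℝ (endA β u v) (endB β u v) = segPoint β u v '' Set.Icc 0 1 := by
  rw [segment_eq_image']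
  refine Set.image_congr fun s _ => ?_
  ext k
  fin_cases k <;> simp [endA, endB, segPoint, realVal_zeros_append, div_eq_mul_inv]

/-- The union of the segments `S_{u,v}` over the pairs satisfying `(⋆)`. -/
def segUnion (β : ℝ) : Set Plane :=
  {q | ∃ u ∈ language (U β), ∃ v ∈ language (U β), Star β u v ∧
    ∃ s ∈ Set.Icc (0 : ℝ) 1, segPoint β u v s = q}

lemma segSet₀_eq (β : ℝ) : segSet₀ β = closure (segUnion β) := by
  unfold segSet₀
  congr 1
  ext q
  simp only [segment_eq_image_segPoint, segUnion, Set.mem_iUnion, Set.mem_image, exists_prop,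
    Set.mem_ofPred_eq]

lemma mem_segSet {n : ℕ} {q : Plane} : q ∈ segSet β n ↔
    ∃ i j, i ≤ n ∧ j ≤ i ∧ ∃ z ∈ segSet₀ β, (h β)^[j] ((c β)^[i] z) = q := by
  simp only [segSet, Set.mem_iUnion, Set.mem_image, exists_prop, exists_exists_and_eq_and]

lemma segSet_mono (β : ℝ) : Monotone (segSet β) := fun m n hmn q hq => by
  obtain ⟨i, j, hi, hj, hz⟩ := mem_segSet.1 hq
  exact mem_segSet.2 ⟨i, j, hi.trans hmn, hj, hz⟩

lemma star_nil (β : ℝ) : Star β [] [] := Or.inl ⟨rfl, rfl⟩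

lemma p_nil (β : ℝ) : p β [] [] = 0 := by simp [p]

namespace IsParryBertrand

lemma nil_mem_language (H : IsParryBertrand β (U β) t r) : [] ∈ language (U β) :=
  H.mem_language.2 ⟨trivial, by simp⟩

lemma segUnion_subset_box (H : IsParryBertrand β (U β) t r) :
    segUnion β ⊆ {q : Plane | ∀ i, q i ∈ Set.Icc (0 : ℝ) 2} := by
  rintro _ ⟨u, hu, v, hv, -, s, hs, rfl⟩
  have hu := (H.mem_language.1 hu).1
  have hv := (H.mem_language.1 hv).1
  have u0 := hu.realVal_nonneg H.one_lt
  have v0 := hv.realVal_nonneg H.one_lt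
  have u1 := hu.realVal_lt_one
  have v1 := hv.realVal_lt_one
  have hβ := zero_lt_one.trans H.one_lt
  have b1 : ∀ (x : ℝ) (k : ℕ), 0 ≤ x → x ≤ 1 → 0 ≤ x / β ^ k ∧ x / β ^ k ≤ 1 := fun x k h0 h1 => by
    refine ⟨by positivity, ?_⟩
    rw [div_le_one (by positivity)]
    exact h1.trans (one_le_pow₀ H.one_lt.le)
  have c1 := b1 s (u.length + p β u v) hs.1 hs.2
  have c2 := b1 _ (u.length - v.length) v0 v1.le
  intro i
  fin_cases i
  · change _ / _ + _ ∈ _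
    constructor <;> linarith [c1.1, c1.2, c2.1, c2.2]
  · change realVal β u + _ ∈ _
    constructor <;> linarith [c1.1, c1.2]

lemma segSet₀_subset_box (H : IsParryBertrand β (U β) t r) :
    segSet₀ β ⊆ {q : Plane | ∀ i, q i ∈ Set.Icc (0 : ℝ) 2} := by
  rw [segSet₀_eq]
  exact closure_minimal H.segUnion_subset_box (isCompact_box 2).isClosed

lemma segSet_subset_box (H : IsParryBertrand β (U β) t r) (n : ℕ) :
    segSet β n ⊆ {q : Plane | ∀ i, q i ∈ Set.Icc (0 : ℝ) 2} := by
  intro q hq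
  obtain ⟨i, j, -, hj, z, hz, rfl⟩ := mem_segSet.1 hq
  have hz := H.segSet₀_subset_box hz
  have hβ := zero_lt_one.trans H.one_lt
  rw [iterate_h_iterate_c]
  intro k
  have hji : β ^ j ≤ β ^ i := pow_le_pow_right₀ H.one_lt.le hj
  fin_cases k
  · change z 0 / β ^ i ∈ _
    refine ⟨div_nonneg (hz 0).1 (by positivity), ?_⟩
    exact (div_le_self (hz 0).1 (one_le_pow₀ H.one_lt.le)).trans (hz 0).2
  · change β ^ j * (z 1 / β ^ i) ∈ _
    have := (hz 1).1
    refine ⟨by positivity, le_trans ?_ (hz 1).2⟩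
    rw [← mul_div_assoc, div_le_iff₀ (by positivity), mul_comm]
    gcongr

lemma isCompact_segSet (H : IsParryBertrand β (U β) t r) (n : ℕ) : IsCompact (segSet β n) := by
  have h0 : IsCompact (segSet₀ β) := by
    rw [segSet₀_eq]
    exact (isCompact_box 2).of_isClosed_subset isClosed_closure
      (by rw [← segSet₀_eq]; exact H.segSet₀_subset_box)
  have e : segSet β n = ⋃ i ∈ Set.Iic n, ⋃ j ∈ Set.Iic i,
      (fun q => (h β)^[j] ((c β)^[i] q)) '' segSet₀ β := by
    ext q
    simp only [mem_segSet, Set.mem_iUnion, Set.mem_image, Set.mem_Iic, exists_prop]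
    exact ⟨fun ⟨i, j, hi, hj, hz⟩ => ⟨i, hi, j, hj, hz⟩,
      fun ⟨i, hi, j, hj, hz⟩ => ⟨i, j, hi, hj, hz⟩⟩
  rw [e]
  exact (Set.finite_Iic n).isCompact_biUnion fun i _ => (Set.finite_Iic i).isCompact_biUnion
    fun j _ => h0.image (continuous_iterate_h_iterate_c β i j)

lemma nonempty_segSet (H : IsParryBertrand β (U β) t r) (n : ℕ) : (segSet β n).Nonempty := by
  refine ⟨_, mem_segSet.2 ⟨0, 0, n.zero_le, le_rfl, segPoint β [] [] 0, ?_, rfl⟩⟩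
  rw [segSet₀_eq]
  exact subset_closure ⟨[], H.nil_mem_language, [], H.nil_mem_language, star_nil β, 0, by simp, rfl⟩

end IsParryBertrand

/-- The common limit `ℒ_β` of the two sequences of sets. -/
def limitSet (β : ℝ) : Set Plane := closure (⋃ n, segSet β n)

lemma limitSet_subset_closure (β : ℝ) : limitSet β ⊆ closure
    {q | ∃ i j, j ≤ i ∧ ∃ z ∈ segUnion β, (h β)^[j] ((c β)^[i] z) = q} := by
  refine closure_minimal ?_ isClosed_closure
  intro q hq
  obtain ⟨n, hn⟩ := Set.mem_iUnion.1 hq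
  obtain ⟨i, j, -, hj, z, hz, rfl⟩ := mem_segSet.1 hn
  rw [segSet₀_eq] at hz
  exact map_mem_closure (f := fun q => (h β)^[j] ((c β)^[i] q))
    (continuous_iterate_h_iterate_c β i j) hz
    fun z hz => ⟨i, j, hj, z, hz, rfl⟩

lemma iterate_mem_limitSet {i j : ℕ} (hj : j ≤ i) {z : Plane} (hz : z ∈ segUnion β) :
    (h β)^[j] ((c β)^[i] z) ∈ limitSet β := by
  refine subset_closure (Set.mem_iUnion.2 ⟨i, mem_segSet.2 ⟨i, j, le_rfl, hj, z, ?_, rfl⟩⟩)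
  rw [segSet₀_eq]
  exact subset_closure hz

lemma IsParryBertrand.isCompact_limitSet (H : IsParryBertrand β (U β) t r) :
    IsCompact (limitSet β) :=
  (isCompact_box 2).of_isClosed_subset isClosed_closure
    (closure_minimal (Set.iUnion_subset H.segSet_subset_box) (isCompact_box 2).isClosed)

/-! ### The limit of the sets `𝒰_n` -/

variable {δ : ℝ}

lemma head?_append_ne_zero {u w : List ℤ} (hu : u ≠ []) (hh : u.head? ≠ some 0) :
    (u ++ w).head? ≠ some 0 := by
  cases u with
  | nil => exact absurd rfl hu
  | cons d u => exact hh

namespace IsParryBertrand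

lemma leftQuot_eq_zeroStar (H : IsParryBertrand β (U β) t r) {K : ℕ}
    (hK : ∀ x w, IsAdmissible β x → IsAdmissible β w → IsAdmissible β (x ++ zeros K ++ w))
    {u : List ℤ} (hu : u ∈ language (U β)) (hu0 : u ≠ []) :
    leftQuot (u ++ zeros K) (language (U β)) = zeroStar (language (U β)) := by
  obtain ⟨h1, h2⟩ := H.mem_language.1 hu
  ext w
  rw [H.mem_zeroStar]
  change u ++ zeros K ++ w ∈ language (U β) ↔ _
  rw [H.mem_language]
  refine ⟨fun h => h.1.of_append, fun hw => ⟨hK _ _ h1 hw, ?_⟩⟩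
  rw [List.append_assoc]
  exact head?_append_ne_zero hu0 h2

lemma p_spec (H : IsParryBertrand β (U β) t r) (hδ0 : 0 < δ) (hδ : ∀ j, δ ≤ r j)
    {u v : List ℤ} (hu : u ∈ language (U β)) (hu0 : u ≠ []) (hv : v ∈ language (U β))
    (hv0 : v ≠ []) :
    leftQuot (u ++ zeros (p β u v)) (language (U β)) = zeroStar (language (U β)) ∧
      leftQuot (v ++ zeros (p β u v)) (language (U β)) = zeroStar (language (U β)) := by
  obtain ⟨K, hK⟩ := H.exists_isAdmissible_append hδ0 hδ
  have e : p β u v = sInf {p | leftQuot (u ++ zeros p) (language (U β)) =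
      zeroStar (language (U β)) ∧ leftQuot (v ++ zeros p) (language (U β)) =
      zeroStar (language (U β))} := by rw [p, if_neg fun h => hu0 h.1]
  rw [e]
  exact Nat.sInf_mem (s := {p | leftQuot (u ++ zeros p) (language (U β)) =
      zeroStar (language (U β)) ∧ leftQuot (v ++ zeros p) (language (U β)) =
      zeroStar (language (U β))})
    ⟨K, H.leftQuot_eq_zeroStar (hK K le_rfl) hu hu0, H.leftQuot_eq_zeroStar (hK K le_rfl) hv hv0⟩

/-- A pair with `(⋆)` remains a pair with an odd binomial coefficient when both words are
completed by `0^p w`, and the first one by further zeros, if `w` does not end with `0`. -/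
lemma exists_odd_binom_of_star (H : IsParryBertrand β (U β) t r) (hδ0 : 0 < δ)
    (hδ : ∀ j, δ ≤ r j) {u v : List ℤ} (hu : u ∈ language (U β)) (hv : v ∈ language (U β))
    (huv : Star β u v) {w : List ℤ} {a : ℤ} (ha : a ≠ 0) (hw : IsAdmissible β (w ++ [a])) :
    ∃ k, ∃ u' ∈ language (U β), ∃ v' ∈ language (U β),
      u ++ zeros (p β u v) ++ (w ++ [a]) = zeros k ++ u' ∧
      v ++ zeros (p β u v) ++ (w ++ [a]) = zeros k ++ v' ∧
      ∀ j, Odd (binom (u' ++ zeros j) v') := by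
  rcases huv with ⟨rfl, rfl⟩ | ⟨hl, hv0, hodd, hext⟩
  · obtain ⟨k, x, hx, hwx⟩ := H.mem_zeroStar.2 hw
    refine ⟨k, x, hx, x, hx, by simpa [p_nil] using hwx, by simpa [p_nil] using hwx, fun j => ?_⟩
    rcases List.eq_nil_or_concat x with rfl | ⟨y, b, rfl⟩
    · rw [binom_nil_right]; exact odd_one
    · have hb : b ≠ 0 := by
        rw [List.concat_eq_append, ← List.append_assoc] at hwx
        have := (List.append_inj' hwx rfl).2
        simp only [List.cons.injEq, and_true] at this
        rwa [← this]
      rw [List.concat_eq_append, binom_append_zeros_concat _ _ hb, binom_self]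
      exact odd_one
  · have hv1 : v ≠ [] := List.length_pos_iff.1 hv0
    have hu1 : u ≠ [] := List.length_pos_iff.1 (by omega)
    obtain ⟨pu, pv⟩ := H.p_spec hδ0 hδ hu hu1 hv hv1
    have hw' := H.mem_zeroStar.2 hw
    refine ⟨0, _, ?_, _, ?_, rfl, rfl, fun j => ?_⟩
    · rw [← pu] at hw'; exact hw'
    · rw [← pv] at hw'; exact hw'
    · change Odd (binom (u ++ zeros (p β u v) ++ (w ++ [a]) ++ zeros j)
        (v ++ zeros (p β u v) ++ (w ++ [a])))
      have e := binom_append_zeros_concat (u ++ zeros (p β u v) ++ (w ++ [a]))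
        (v ++ zeros (p β u v) ++ w) ha j
      rw [List.append_assoc (v ++ zeros (p β u v))] at e
      rw [e, binom_append_append _ fun b hb => hext b (hw.digit_le H.one_lt hb).1
        (hw.digit_le H.one_lt hb).2]
      exact hodd

lemma val_lt (H : IsParryBertrand β (U β) t r) {u : List ℤ} (hu : u ∈ language (U β)) {n : ℕ}
    (hn : u.length ≤ n) : val (U β) u < U β n :=
  ((H.isGreedy_iff.2 (H.mem_language.1 hu).1).val_lt H.U_pos).trans_le (H.strictMono.monotone hn)

lemma length_le (H : IsParryBertrand β (U β) t r) {u : List ℤ} (hu : u ∈ language (U β)) {n : ℕ}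
    (hn : val (U β) u < U β n) : u.length ≤ n :=
  (H.isGreedy_iff.2 (H.mem_language.1 hu).1).length_le H.U_pos H.strictMono
    (H.mem_language.1 hu).2 hn

lemma exists_abs_val_div_sub_le_of_add (H : IsParryBertrand β (U β) t r) {ε : ℝ} (hε : 0 < ε) :
    ∃ N, ∀ n, N ≤ n → ∀ u, IsAdmissible β u → ∀ m, u.length + m = n →
      |(val (U β) u : ℝ) / U β n - realVal β u / β ^ m| ≤ ε := by
  obtain ⟨N, hN⟩ := H.exists_abs_val_div_sub_le hε
  refine ⟨N, fun n hn u hu m hm => ?_⟩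
  have hl : (zeros m ++ u).length = n := by simp; omega
  have := hN (zeros m ++ u) (isAdmissible_zeros_append H.one_lt m hu) (by omega)
  rwa [val_zeros_append, realVal_zeros_append, hl] at this

lemma mem_language_append_zeros (H : IsParryBertrand β (U β) t r) {u : List ℤ}
    (hu : u ∈ language (U β)) (hu0 : u ≠ []) (j : ℕ) : u ++ zeros j ∈ language (U β) := by
  obtain ⟨h1, h2⟩ := H.mem_language.1 hu
  exact H.mem_language.2 ⟨h1.append_zeros H.one_lt j, head?_append_ne_zero hu0 h2⟩

/-- Numbers of `[0, 1]` are approximated by the values of long admissible words which end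
with `1`. -/
lemma exists_isAdmissible_concat_one (H : IsParryBertrand β (U β) t r) (hδ0 : 0 < δ)
    (hδ : ∀ j, δ ≤ r j) {s ε : ℝ} (hs : s ∈ Set.Icc (0 : ℝ) 1) (hε : 0 < ε) :
    ∃ N, ∀ l, N ≤ l → ∃ w, IsAdmissible β (w ++ [1]) ∧ (w ++ [1]).length = l ∧
      |realVal β (w ++ [1]) - s| ≤ ε := by
  have hβ := zero_lt_one.trans H.one_lt
  obtain ⟨K, hK⟩ := H.exists_isAdmissible_append hδ0 hδ
  obtain ⟨M, hM⟩ := pow_unbounded_of_one_lt (2 / ε) H.one_lt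
  refine ⟨M + K + 1, fun l hl => ?_⟩
  obtain ⟨x, hx, hxl, hxs⟩ := exists_isAdmissible_abs_sub_le H.one_lt (l - K - 1) hs
  refine ⟨x ++ zeros K, hK K le_rfl x [1] hx (isAdmissible_singleton_one H.one_lt),
    by simp; omega, ?_⟩
  have h1 : (1 : ℝ) / β ^ (l - K - 1) ≤ ε / 2 := by
    have : β ^ M ≤ β ^ (l - K - 1) := pow_le_pow_right₀ H.one_lt.le (by omega)
    rw [div_lt_iff₀ hε] at hM
    rw [div_le_div_iff₀ (by positivity) two_pos]
    nlinarith
  have hz := isAdmissible_zeros_append H.one_lt K (isAdmissible_singleton_one H.one_lt)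
  have h2 := hz.realVal_nonneg H.one_lt
  have h3 : realVal β (zeros K ++ [1]) / β ^ (l - K - 1) ≤ 1 / β ^ (l - K - 1) := by
    have := hz.realVal_lt_one
    gcongr
  have h4 : 0 ≤ realVal β (zeros K ++ [1]) / β ^ (l - K - 1) := by positivity
  rw [List.append_assoc, realVal_append, hxl]
  rw [abs_le] at hxs ⊢
  constructor <;> linarith [hxs.1, hxs.2]

/-- Each point of the images of the segments is approached by the sets `𝒰_n`. -/
lemma eventually_exists_mem_pascalSet (H : IsParryBertrand β (U β) t r) (hδ0 : 0 < δ)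
    (hδ : ∀ j, δ ≤ r j) {i j : ℕ} (hji : j ≤ i) {z : Plane} (hz : z ∈ segUnion β) {ε : ℝ}
    (hε : 0 < ε) :
    ∀ᶠ n in atTop, ∃ y ∈ pascalSet β n, dist ((h β)^[j] ((c β)^[i] z)) y ≤ ε := by
  have hβ := zero_lt_one.trans H.one_lt
  obtain ⟨u, hu, v, hv, huv, s, hs, rfl⟩ := hz
  obtain ⟨N₁, hN₁⟩ := H.exists_abs_val_div_sub_le_of_add (ε := ε / 4) (by linarith)
  obtain ⟨N₂, hN₂⟩ := H.exists_isAdmissible_concat_one hδ0 hδ hs (ε := ε / 4) (by linarith)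
  have hvu : v.length ≤ u.length := by
    rcases huv with ⟨rfl, rfl⟩ | h
    · exact le_rfl
    · exact h.1
  filter_upwards [eventually_ge_atTop (N₁ + N₂ + i + u.length + p β u v)] with n hn
  obtain ⟨w, hw, hwl, hws⟩ := hN₂ (n - i - u.length - p β u v) (by omega)
  obtain ⟨k, u', hu', v', hv', eu, ev, hodd⟩ :=
    H.exists_odd_binom_of_star hδ0 hδ hu hv huv one_ne_zero hw
  set e := realVal β (w ++ [1]) with he
  have lu : u.length + p β u v + (w ++ [1]).length = k + u'.length := by
    simpa [add_assoc] using congrArg List.length eu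
  have lv : v.length + p β u v + (w ++ [1]).length = k + v'.length := by
    simpa [add_assoc] using congrArg List.length ev
  have ru : realVal β u + e / β ^ (u.length + p β u v) = realVal β u' / β ^ k := by
    have := congrArg (realVal β) eu
    rwa [realVal_append, realVal_append_zeros, realVal_zeros_append, List.length_append,
      length_zeros] at this
  have rv : realVal β v + e / β ^ (v.length + p β u v) = realVal β v' / β ^ k := by
    have := congrArg (realVal β) ev
    rwa [realVal_append, realVal_append_zeros, realVal_zeros_append, List.length_append,
      length_zeros] at this
  have hu'0 : u' ≠ [] := by
    rintro rfl
    have := congrArg List.getLast? eu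
    rw [← List.append_assoc, List.getLast?_concat, List.append_nil] at this
    rcases k with _ | k
    · simp at this
    · rw [zeros_succ, List.getLast?_concat] at this
      simp at this
  have hu'j := H.mem_language_append_zeros hu' hu'0 j
  refine ⟨_, corner_mem_pascalSet (n := n) hu'j hv' (H.val_lt hu'j ?_) (H.val_lt hv' (by omega))
    (hodd j), ?_⟩
  · rw [List.length_append, length_zeros]; omega
  have ay := hN₁ n (by omega) _ (H.mem_language.1 hu'j).1 (i - j + k)
    (by rw [List.length_append, length_zeros]; omega)
  have ax := hN₁ n (by omega) _ (H.mem_language.1 hv').1 (i + (u.length - v.length) + k) (by omega)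
  rw [realVal_append_zeros] at ay
  -- The coordinates of the corner are approximations of the coordinates of the point of the
  -- segment of parameter `e`.
  have ex : realVal β v' / β ^ (i + (u.length - v.length) + k) =
      (realVal β v / β ^ (u.length - v.length) + e / β ^ (u.length + p β u v)) / β ^ i := by
    rw [pow_add _ _ k, mul_comm, ← div_div, ← rv, pow_add _ i, mul_comm, ← div_div,
      add_div (_ : ℝ) _ (β ^ (u.length - v.length)), div_div e, ← pow_add,
      show v.length + p β u v + (u.length - v.length) = u.length + p β u v by omega]
  have ey : realVal β u' / β ^ (i - j + k) =
      β ^ j * ((realVal β u + e / β ^ (u.length + p β u v)) / β ^ i) := by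
    rw [ru, pow_add, mul_comm, ← div_div, show i = (i - j) + j by omega, pow_add,
      Nat.add_sub_cancel]
    field_simp
  rw [ex] at ax
  rw [ey] at ay
  rw [iterate_h_iterate_c]
  refine (dist_le_abs_add_abs _ _ _ _).trans ?_
  have hpi : ∀ k, (1 : ℝ) ≤ β ^ k := fun k => one_le_pow₀ H.one_lt.le
  have hji' : β ^ j ≤ β ^ i := pow_le_pow_right₀ H.one_lt.le hji
  have dx : |(segPoint β u v s) 0 / β ^ i -
      (realVal β v / β ^ (u.length - v.length) + e / β ^ (u.length + p β u v)) / β ^ i| ≤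
      ε / 4 := by
    rw [← sub_div]
    change |(_ + s / β ^ (u.length + p β u v) - _) / _| ≤ _
    rw [add_sub_add_left_eq_sub, ← sub_div, abs_div, abs_div,
      abs_of_nonneg (zero_le_one.trans (hpi _)), abs_of_nonneg (zero_le_one.trans (hpi _)),
      abs_sub_comm]
    exact ((div_le_self (by positivity) (hpi _)).trans
      (div_le_self (by positivity) (hpi _))).trans hws
  have dy : |β ^ j * ((segPoint β u v s) 1 / β ^ i) -
      β ^ j * ((realVal β u + e / β ^ (u.length + p β u v)) / β ^ i)| ≤ ε / 4 := by
    rw [← mul_sub, ← sub_div]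
    change |_ * ((_ + s / β ^ (u.length + p β u v) - _) / _)| ≤ _
    rw [add_sub_add_left_eq_sub, ← sub_div, ← mul_div_assoc, abs_div, abs_mul, abs_div,
      abs_of_nonneg (zero_le_one.trans (hpi _)), abs_of_nonneg (zero_le_one.trans (hpi _)),
      abs_of_nonneg (zero_le_one.trans (hpi _)), abs_sub_comm,
      div_le_iff₀ (by positivity), mul_comm]
    have := (div_le_self (abs_nonneg _) (hpi (u.length + p β u v))).trans hws
    gcongr
  rw [abs_sub_comm] at ax ay
  have tx := abs_sub_le _ _ _ |>.trans (add_le_add dx ax)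
  have ty := abs_sub_le _ _ _ |>.trans (add_le_add dy ay)
  linarith

/-- The pairs of nonempty words with an odd binomial coefficient are approximated by pairs
with `(⋆)`, at the cost of the digits of weight smaller than the last one. -/
lemma exists_star_of_odd_binom (H : IsParryBertrand β (U β) t r) (hδ0 : 0 < δ)
    (hδ : ∀ j, δ ≤ r j) {u v : List ℤ} (hu : u ∈ language (U β)) (hv : v ∈ language (U β))
    (hv0 : v ≠ []) (huv : Odd (binom u v)) :
    ∃ y, IsAdmissible β y ∧ u ++ y ∈ language (U β) ∧ v ++ y ∈ language (U β) ∧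
      Star β (u ++ y) (v ++ y) := by
  obtain ⟨K, hK⟩ := H.exists_isAdmissible_append hδ0 hδ
  have hsub : v.Sublist u := by
    by_contra h
    rw [binom_eq_zero_iff.2 h] at huv
    simp at huv
  have hvu := hsub.length_le
  have hvl := List.length_pos_iff.2 hv0
  have hu0 : u ≠ [] := List.length_pos_iff.1 (by omega)
  set q := u.length + K with hq
  have hq2 : q < 2 ^ q := Nat.lt_two_pow_self
  have hone := isAdmissible_singleton_one H.one_lt
  have hL : ∀ x ∈ language (U β), x ≠ [] → x ++ (zeros (2 ^ q) ++ [1]) ∈ language (U β) := by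
    intro x hx hx0
    obtain ⟨h1, h2⟩ := H.mem_language.1 hx
    refine H.mem_language.2 ⟨?_, head?_append_ne_zero hx0 h2⟩
    rw [← List.append_assoc]
    exact hK _ (by omega) x [1] h1 hone
  refine ⟨zeros (2 ^ q) ++ [1], isAdmissible_zeros_append H.one_lt _ hone, hL u hu hu0,
    hL v hv hv0, Or.inr ⟨?_, ?_, ?_, ?_⟩⟩
  · simp only [List.length_append]; omega
  · simp only [List.length_append]; omega
  · obtain ⟨o1, o2⟩ := odd_binom_append_zeros_one huv (q := q) (by omega)
    rw [← List.append_assoc, ← List.append_assoc, binom_append_append _ fun a _ => o2 a]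
    exact o1
  · intro a _ _
    obtain ⟨o1, o2⟩ := odd_binom_append_zeros_one huv (q := q) (by omega)
    rw [← List.append_assoc, ← List.append_assoc]
    exact binom_append_append_concat _ a o2

/-- The sets `𝒰_n` are eventually close to the limit set. -/
lemma eventually_exists_mem_limitSet (H : IsParryBertrand β (U β) t r) (hδ0 : 0 < δ)
    (hδ : ∀ j, δ ≤ r j) {ε : ℝ} (hε : 0 < ε) :
    ∀ᶠ n in atTop, ∀ x ∈ pascalSet β n, ∃ y ∈ limitSet β, dist x y ≤ ε := by
  have hβ := zero_lt_one.trans H.one_lt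
  obtain ⟨N₁, hN₁⟩ := H.exists_abs_val_div_sub_le_of_add (ε := ε / 6) (by linarith)
  have hpow : ∀ᶠ n : ℕ in atTop, 1 / β ^ n ≤ ε / 6 := by
    filter_upwards [(tendsto_pow_atTop_atTop_of_one_lt H.one_lt).eventually_ge_atTop (6 / ε)]
      with n hn
    rw [div_le_iff₀ hε] at hn
    rw [div_le_div_iff₀ (by positivity) (by norm_num)]
    linarith
  filter_upwards [eventually_ge_atTop N₁, hpow,
    H.tendsto_U.eventually_ge_atTop (6 / ε)] with n hn1 hn2 hn3 x hx
  obtain ⟨u, hu, v, hv, hun, hvn, huv, hd⟩ := H.exists_corner hx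
  have hUn : (0 : ℝ) < U β n := by exact_mod_cast H.U_pos n
  have hd' : (2 : ℝ) / U β n ≤ ε / 3 := by
    rw [div_le_iff₀ hε] at hn3
    rw [div_le_div_iff₀ hUn (by norm_num)]
    linarith
  have hul := H.length_le hu hun
  have hvl := H.length_le hv hvn
  have au := hN₁ n hn1 u (H.mem_language.1 hu).1 (n - u.length) (by omega)
  have av := hN₁ n hn1 v (H.mem_language.1 hv).1 (n - v.length) (by omega)
  have hu1 := (H.mem_language.1 hu).1.realVal_lt_one
  have hu2 := (H.mem_language.1 hu).1.realVal_nonneg H.one_lt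
  suffices hs : ∃ a b : ℝ, (!₂[a, b] : Plane) ∈ limitSet β ∧
      |realVal β v / β ^ (n - v.length) - a| ≤ 1 / β ^ n ∧
      |realVal β u / β ^ (n - u.length) - b| ≤ 1 / β ^ n by
    obtain ⟨a, b, hab, ha, hb⟩ := hs
    refine ⟨_, hab, ((dist_triangle _ _ _).trans
      (add_le_add hd (dist_le_abs_add_abs _ _ _ _))).trans ?_⟩
    have tx := abs_sub_le _ _ _ |>.trans (add_le_add av ha)
    have ty := abs_sub_le _ _ _ |>.trans (add_le_add au hb)
    linarith
  by_cases hv0 : v = []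
  · -- The corner is on the left side of the square, close to the image of the diagonal by
    -- `h^n c^n`.
    subst hv0
    set s := realVal β u / β ^ (n - u.length) with hs
    have hs0 : 0 ≤ s := by positivity
    have hs1 : s ≤ 1 := (div_le_self hu2 (one_le_pow₀ H.one_lt.le)).trans hu1.le
    refine ⟨s / β ^ n, s, ?_, ?_, ?_⟩
    · have hmem := iterate_mem_limitSet (i := n) (j := n) (le_refl _) (z := segPoint β [] [] s)
        ⟨[], H.nil_mem_language, [], H.nil_mem_language, star_nil β, s, ⟨hs0, hs1⟩, rfl⟩
      rw [iterate_h_iterate_c, mul_div_cancel₀ _ (by positivity)] at hmem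
      have e0 : segPoint β [] [] s = !₂[s, s] := by simp [segPoint, p_nil, realVal]
      rw [e0] at hmem
      exact hmem
    · rw [realVal, zero_div, zero_sub, abs_neg, abs_of_nonneg (by positivity)]
      gcongr
    · rw [sub_self, abs_zero]; positivity
  · obtain ⟨y, hy, huy, hvy, hstar⟩ := H.exists_star_of_odd_binom hδ0 hδ hu hv hv0 huv
    have hy0 := hy.realVal_nonneg H.one_lt
    have hy1 := hy.realVal_lt_one.le
    have hmem := iterate_mem_limitSet (i := n - u.length) (j := 0) (Nat.zero_le _)
      (z := segPoint β (u ++ y) (v ++ y) 0) ⟨_, huy, _, hvy, hstar, 0, by simp, rfl⟩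
    rw [iterate_h_iterate_c, pow_zero, one_mul] at hmem
    have hle : v.length ≤ u.length := by
      have : v.Sublist u := by
        by_contra hns
        rw [binom_eq_zero_iff.2 hns] at huv
        simp at huv
      exact this.length_le
    have key : ∀ x : List ℤ, x.length ≤ n → |realVal β x / β ^ (n - x.length) -
        realVal β (x ++ y) / β ^ (n - x.length)| ≤ 1 / β ^ n := fun x hx => by
      rw [← sub_div, realVal_append, sub_add_cancel_left, neg_div, abs_neg, div_div, ← pow_add,
        Nat.add_sub_cancel' hx, abs_of_nonneg (by positivity)]
      gcongr
    refine ⟨_, _, hmem, ?_, ?_⟩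
    · change |_ - (realVal β (v ++ y) / _ + 0 / _) / _| ≤ _
      have e : (u ++ y).length - (v ++ y).length + (n - u.length) = n - v.length := by
        simp only [List.length_append]; omega
      rw [zero_div, add_zero, div_div, ← pow_add, e]
      exact key v hvl
    · change |_ - (realVal β (u ++ y) + 0 / _) / _| ≤ _
      rw [zero_div, add_zero]
      exact key u hul

end IsParryBertrand

end ParryBertrand

theorem mainTheorem1 (β : ℝ) (hβ : ParryBertrand.IsParry β) :
    ∃ (𝒰 𝒜 : ℕ → NonemptyCompacts ParryBertrand.Plane)
      (L : NonemptyCompacts ParryBertrand.Plane),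
      (∀ n, (𝒰 n : Set ParryBertrand.Plane) = ParryBertrand.pascalSet β n) ∧
      (∀ n, (𝒜 n : Set ParryBertrand.Plane) = ParryBertrand.segSet β n) ∧
      Tendsto (fun n => dist (𝒜 n) L) atTop (𝓝 0) ∧
      Tendsto (fun n => dist (𝒰 n) L) atTop (𝓝 0) := by
  obtain ⟨t, r, δ, H, hδ0, hδ⟩ := hβ.exists_isParryBertrand
  have hne : ∀ n, (ParryBertrand.pascalSet β n).Nonempty := fun n =>
    ⟨_, ParryBertrand.corner_mem_pascalSet H.nil_mem_language H.nil_mem_language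
      (H.val_lt H.nil_mem_language n.zero_le) (H.val_lt H.nil_mem_language n.zero_le)
      (by rw [ParryBertrand.binom_nil_right]; exact odd_one)⟩
  have hsub : ∀ n, ParryBertrand.segSet β n ⊆ ParryBertrand.limitSet β := fun n =>
    (Set.subset_iUnion _ n).trans subset_closure
  refine ⟨fun n => ⟨⟨_, H.isCompact_pascalSet n⟩, hne n⟩,
    fun n => ⟨⟨_, H.isCompact_segSet n⟩, H.nonempty_segSet n⟩,
    ⟨⟨_, H.isCompact_limitSet⟩, (H.nonempty_segSet 0).mono (hsub 0)⟩,
    fun n => rfl, fun n => rfl, ?_, ?_⟩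
  · refine ParryBertrand.tendsto_dist_nonemptyCompacts
      (S := ⋃ n, ParryBertrand.segSet β n) subset_rfl
      (fun ε hε => Eventually.of_forall fun n x hx => ⟨x, hsub n hx, by simpa using hε.le⟩)
      fun x hx ε hε => ?_
    obtain ⟨m, hm⟩ := Set.mem_iUnion.1 hx
    filter_upwards [eventually_ge_atTop m] with n hn
    exact ⟨x, ParryBertrand.segSet_mono β hn hm, by simpa using hε.le⟩
  · refine ParryBertrand.tendsto_dist_nonemptyCompacts
      (ParryBertrand.limitSet_subset_closure β)
      (fun ε hε => H.eventually_exists_mem_limitSet hδ0 hδ hε) ?_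
    rintro _ ⟨i, j, hji, z, hz, rfl⟩ ε hε
    exact H.eventually_exists_mem_pascalSet hδ0 hδ hji hz hε
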